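/- Let $q$ be a nonzero complex number and let $S^2_q$ be the unital complex algebra generated by $z,\bar z$ with $z\bar z=q^{-2}\bar z z+q^{-2}-1$ and with $R+1$ made invertible, where $R=\bar z z$. Give it the differential calculus in which $\Omega^1$ is free as a right module on $dz,d\bar z$ with $$z.dz=q^{-2}dz.z,\quad z.d\bar z=q^{-2}d\bar z.z,\quad \bar z.dz=q^2dz.\bar z,\quad \bar z.d\bar z=q^2d\bar z.\bar z,$$ and $\Omega^2$ is free on $dz\wedge d\bar z=-q^{-2}d\bar z\wedge dz$, with $dz\wedge dz=d\bar z\wedge d\bar z=0$. Write $z^1=z$, $z^2=\bar z$. Let $\mathrm{Vec}$ be the bimodule of right module maps $\Omega^1\to S^2_q$, with $(a.X)(\xi)=a\,X(\xi)$ and $(X.a)(\xi)=X(a.\xi)$. (1) There are $\partial_z,\partial_{\bar z}\in\mathrm{Vec}$ with $\partial_z(dz)=\partial_{\bar z}(d\bar z)=1$ and $\partial_z(d\bar z)=\partial_{\bar z}(dz)=0$, and they generate $\mathrm{Vec}$ as a left module. (2) Let $A^2\subset\mathrm{Vec}\otimes_{\mathbb C}\mathrm{Vec}$ be the set of elements annihilating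 $\ker(\wedge:\Omega^1\otimes_{S^2_q}\Omega^1\to\Omega^2)$ under the pairing $\langle X\otimes Y,\xi\otimes\eta\rangle=X(Y(\xi).\eta)$, and let $\phi:A^2\to\mathrm{Vec}$ be the Lie bracket, the linear map given by $\phi(X\otimes Y)(\xi)=X(d(Y(\xi)))+\langle X\otimes Y,\zeta\rangle$ (extended linearly to sums), where $\wedge\zeta=d\xi$. Then $\partial_{\bar z}\otimes\partial_z-q^2\,\partial_z\otimes\partial_{\bar z}\in A^2$ and $$\phi(\partial_{\bar z}\otimes\partial_z-q^2\,\partial_z\otimes\partial_{\bar z})=0.$$ (3) Let $g_{ij0},h_{ij0},h_{ij1}\in\mathbb C$ ($1\le i,j\le2$), and let $(\nabla,\sigma)$ be a bimodule covariant derivative on $\Omega^1$: a linear map $\nabla:\Omega^1\to\Omega^1\otimes_{S^2_q}\Omega^1$ and a bimodule map $\sigma:\Omega^1\otimes_{S^2_q}\Omega^1\to\Omega^1\otimes_{S^2_q}\Omega^1$ with $\nabla(a.\xi)=da\otimes\xi+a.\nabla\xi$ and $\nabla(\xi.a)=\nabla(\xi).a+\sigma(\xi\otimes da)$. Suppose that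 $$\nabla(dz)=q^{-2}(R+1)^{-1}\bar z.dz\otimes dz+(R+1)^{-1}\sum_{i,j}(g_{ij0}+q^6h_{ij1}z)\,dz^i\otimes dz^j,$$ $$\nabla(d\bar z)=q^{4}(R+1)^{-1}z.d\bar z\otimes d\bar z+(R+1)^{-1}\sum_{i,j}(h_{ij0}+h_{ij1}\bar z)\,dz^i\otimes dz^j,$$ and that $\sigma$ is invertible. For any finite dual basis $(\xi_i,X_i)$ of $\Omega^1$ (that is, $\xi_i\in\Omega^1$, $X_i\in\mathrm{Vec}$, $\sum_i\xi_i.X_i(\eta)=\eta$ for all $\eta$), let $\sigma_{\mathrm{Vec}}:\mathrm{Vec}\otimes_{S^2_q}\Omega^1\to\Omega^1\otimes_{S^2_q}\mathrm{Vec}$ be the induced braiding $$\sigma_{\mathrm{Vec}}(X\otimes\xi)=\sum_i(\mathrm{ev}\otimes\mathrm{id})\big(X\otimes\sigma^{-1}(\xi\otimes\xi_i)\big)\otimes X_i .$$ Put $x=(q^2-1)(h_{121}-q^2h_{211})-1$. Then $x\neq0$ and $$\sigma_{\mathrm{Vec}}(\partial_z\otimes dz)=dz\otimes\partial_z+\frac{h_{111}(1-q^2)}{x}dz\otimes\partial_{\bar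 z}+\frac{h_{211}(q^2-q^4)}{x}d\bar z\otimes\partial_{\bar z},$$ $$\sigma_{\mathrm{Vec}}(\partial_z\otimes d\bar z)=\frac{h_{111}(q^4-q^2)}{x}dz\otimes\partial_z+\frac{h_{121}(q^4-q^2)-q^2}{x}d\bar z\otimes\partial_z,$$ $$\sigma_{\mathrm{Vec}}(\partial_{\bar z}\otimes dz)=\frac{h_{211}(1-q^2)-1/q^2}{x}dz\otimes\partial_{\bar z}+\frac{h_{221}(1-q^2)}{x}d\bar z\otimes\partial_{\bar z},$$ $$\sigma_{\mathrm{Vec}}(\partial_{\bar z}\otimes d\bar z)=\frac{h_{121}(q^2-1)}{x}dz\otimes\partial_z+\frac{h_{221}(q^4-q^2)}{x}d\bar z\otimes\partial_z+d\bar z\otimes\partial_{\bar z}.$$ (4) If moreover $\sigma_{\mathrm{Vec}}$ is invertible, then $x^2+q^2(q^2-1)^2(h_{121}h_{211}-h_{111}h_{221})\ne0$, and the differential dimension $\dim S^2_q=\mathrm{ev}(\sigma_{\mathrm{Vec}}^{-1}\delta)$, where $\delta=\sum_i\xi_i\otimes X_i\in\Omega^1\otimes_{S^2_q}\mathrm{Vec}$,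 is the scalar $$\dim S^2_q=\frac{x(x-1)}{x^2+q^2(q^2-1)^2(h_{121}h_{211}-h_{111}h_{221})}.$$ -/

import Mathlib

open scoped TensorProduct

set_option linter.unusedSectionVars false

noncomputable section

namespace NCG

open MulOpposite

/-! Algebras are unital associative algebras over `ℂ`. A bimodule over `A` is a complex vector
space with commuting actions of `A` and `Aᵐᵒᵖ`; the right action `e.a` is `op a • e`. -/

/-! ### The tensor product over a noncommutative algebra -/

section Tensor

variable (A : Type*) [Ring A] [Algebra ℂ A]
  (E : Type*) [AddCommGroup E] [Module ℂ E] [Module Aᵐᵒᵖ E]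
  (F : Type*) [AddCommGroup F] [Module ℂ F] [Module A F]

/-- The span of the elements `e.a ⊗ f - e ⊗ a.f`. -/
def balancing : Submodule ℂ (E ⊗[ℂ] F) :=
  Submodule.span ℂ {t | ∃ (e : E) (a : A) (f : F), t = (op a • e) ⊗ₜ f - e ⊗ₜ (a • f)}

/-- The tensor product `E ⊗_A F` of a right module and a left module. -/
def BTensor : Type _ := (E ⊗[ℂ] F) ⧸ balancing A E F

instance : AddCommGroup (BTensor A E F) :=
  inferInstanceAs (AddCommGroup ((E ⊗[ℂ] F) ⧸ balancing A E F))

instance : Module ℂ (BTensor A E F) :=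
  inferInstanceAs (Module ℂ ((E ⊗[ℂ] F) ⧸ balancing A E F))

variable {E F}

/-- The pure tensor `e ⊗ f` in `E ⊗_A F`. -/
def bt (e : E) (f : F) : BTensor A E F := (balancing A E F).mkQ (e ⊗ₜ f)

theorem bt_balanced (e : E) (a : A) (f : F) : bt A (op a • e) f = bt A e (a • f) := by
  refine (Submodule.Quotient.eq _).2 (Submodule.subset_span ⟨e, a, f, rfl⟩)

/-- The universal property: balanced bilinear maps descend to `E ⊗_A F`. -/
def BTensor.lift {G : Type*} [AddCommGroup G] [Module ℂ G] (f : E →ₗ[ℂ] F →ₗ[ℂ] G)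
    (hf : ∀ (e : E) (a : A) (x : F), f (op a • e) x = f e (a • x)) : BTensor A E F →ₗ[ℂ] G :=
  (balancing A E F).liftQ (TensorProduct.lift f) (by
    rw [balancing, Submodule.span_le]
    rintro _ ⟨e, a, x, rfl⟩
    simp [hf])

@[simp] theorem BTensor.lift_bt {G : Type*} [AddCommGroup G] [Module ℂ G]
    (f : E →ₗ[ℂ] F →ₗ[ℂ] G)
    (hf : ∀ (e : E) (a : A) (x : F), f (op a • e) x = f e (a • x)) (e : E) (x : F) :
    BTensor.lift A f hf (bt A e x) = f e x := by
  rfl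

variable (E F) in
/-- `(e, f) ↦ e ⊗ f` as a bilinear map. -/
def btₗ : E →ₗ[ℂ] F →ₗ[ℂ] BTensor A E F :=
  (TensorProduct.mk ℂ E F).compr₂ (balancing A E F).mkQ

@[simp] theorem btₗ_apply (e : E) (f : F) : btₗ A E F e f = bt A e f := rfl

theorem add_bt (e e' : E) (f : F) : bt A (e + e') f = bt A e f + bt A e' f :=
  (btₗ A E F).map_add₂ e e' f

theorem bt_add (e : E) (f f' : F) : bt A e (f + f') = bt A e f + bt A e f' :=
  (btₗ A E F e).map_add f f'

theorem csmul_bt (c : ℂ) (e : E) (f : F) : bt A (c • e) f = c • bt A e f :=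
  (btₗ A E F).map_smul₂ c e f

theorem bt_csmul (c : ℂ) (e : E) (f : F) : bt A e (c • f) = c • bt A e f :=
  (btₗ A E F e).map_smul c f

theorem zero_bt (f : F) : bt A (0 : E) f = 0 := (btₗ A E F).map_zero₂ f

theorem bt_zero (e : E) : bt A e (0 : F) = 0 := (btₗ A E F e).map_zero

variable {A} in
theorem BTensor.ext {G : Type*} [AddCommGroup G] [Module ℂ G] {f g : BTensor A E F →ₗ[ℂ] G}
    (h : ∀ e x, f (bt A e x) = g (bt A e x)) : f = g := by
  refine Submodule.linearMap_qext _ (TensorProduct.ext' fun e x => h e x)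

end Tensor

section TensorBimodule

variable (A : Type*) [Ring A] [Algebra ℂ A]
  (E : Type*) [AddCommGroup E] [Module ℂ E] [Module A E] [Module Aᵐᵒᵖ E]
  [SMulCommClass A Aᵐᵒᵖ E] [IsScalarTower ℂ A E]
  (F : Type*) [AddCommGroup F] [Module ℂ F] [Module A F] [Module Aᵐᵒᵖ F]
  [SMulCommClass A Aᵐᵒᵖ F] [IsScalarTower ℂ Aᵐᵒᵖ F]

/-- The left action `a.(e ⊗ f) = (a.e) ⊗ f`. -/
def BTensor.leftAct (a : A) : BTensor A E F →ₗ[ℂ] BTensor A E F :=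
  BTensor.lift A ((btₗ A E F).comp (Algebra.lsmul ℂ ℂ E a)) (by
    intro e b x
    simp only [LinearMap.comp_apply, Algebra.lsmul_coe, btₗ_apply]
    rw [smul_comm a (op b) e, bt_balanced])

@[simp] theorem BTensor.leftAct_bt (a : A) (e : E) (f : F) :
    BTensor.leftAct A E F a (bt A e f) = bt A (a • e) f := by
  simp [BTensor.leftAct]

/-- The right action `(e ⊗ f).a = e ⊗ (f.a)`. -/
def BTensor.rightAct (a : Aᵐᵒᵖ) : BTensor A E F →ₗ[ℂ] BTensor A E F :=
  BTensor.lift A ((btₗ A E F).compl₂ (Algebra.lsmul ℂ ℂ F a)) (by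
    intro e b x
    simp only [LinearMap.compl₂_apply, Algebra.lsmul_coe, btₗ_apply]
    rw [bt_balanced, smul_comm b a x])

@[simp] theorem BTensor.rightAct_bt (a : Aᵐᵒᵖ) (e : E) (f : F) :
    BTensor.rightAct A E F a (bt A e f) = bt A e (a • f) := by
  simp [BTensor.rightAct]

instance : Module A (BTensor A E F) where
  smul a t := BTensor.leftAct A E F a t
  one_smul t := by
    change BTensor.leftAct A E F 1 t = (LinearMap.id : BTensor A E F →ₗ[ℂ] _) t
    congr 1; apply BTensor.ext; intros; simp
  mul_smul a b t := by
    change BTensor.leftAct A E F (a * b) t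
      = ((BTensor.leftAct A E F a).comp (BTensor.leftAct A E F b)) t
    congr 1; apply BTensor.ext; intros; simp [mul_smul]
  smul_zero a := map_zero (BTensor.leftAct A E F a)
  smul_add a s t := map_add (BTensor.leftAct A E F a) s t
  add_smul a b t := by
    change BTensor.leftAct A E F (a + b) t
      = (BTensor.leftAct A E F a + BTensor.leftAct A E F b) t
    congr 1; apply BTensor.ext; intro e x
    simp only [LinearMap.add_apply, BTensor.leftAct_bt, add_smul, add_bt]
  zero_smul t := by
    change BTensor.leftAct A E F 0 t = (0 : BTensor A E F →ₗ[ℂ] BTensor A E F) t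
    congr 1; apply BTensor.ext; intro e x
    simp only [LinearMap.zero_apply, BTensor.leftAct_bt, zero_smul, zero_bt]

instance : Module Aᵐᵒᵖ (BTensor A E F) where
  smul a t := BTensor.rightAct A E F a t
  one_smul t := by
    change BTensor.rightAct A E F 1 t = (LinearMap.id : BTensor A E F →ₗ[ℂ] _) t
    congr 1; apply BTensor.ext; intros; simp
  mul_smul a b t := by
    change BTensor.rightAct A E F (a * b) t
      = ((BTensor.rightAct A E F a).comp (BTensor.rightAct A E F b)) t
    congr 1; apply BTensor.ext; intros; simp [mul_smul]
  smul_zero a := map_zero (BTensor.rightAct A E F a)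
  smul_add a s t := map_add (BTensor.rightAct A E F a) s t
  add_smul a b t := by
    change BTensor.rightAct A E F (a + b) t
      = (BTensor.rightAct A E F a + BTensor.rightAct A E F b) t
    congr 1; apply BTensor.ext; intro e x
    simp only [LinearMap.add_apply, BTensor.rightAct_bt, add_smul, bt_add]
  zero_smul t := by
    change BTensor.rightAct A E F 0 t = (0 : BTensor A E F →ₗ[ℂ] BTensor A E F) t
    congr 1; apply BTensor.ext; intro e x
    simp only [LinearMap.zero_apply, BTensor.rightAct_bt, zero_smul, bt_zero]

@[simp] theorem smul_bt (a : A) (e : E) (f : F) : a • bt A e f = bt A (a • e) f :=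
  BTensor.leftAct_bt A E F a e f

@[simp] theorem op_smul_bt (a : A) (e : E) (f : F) : op a • bt A e f = bt A e (op a • f) :=
  BTensor.rightAct_bt A E F (op a) e f

end TensorBimodule

/-! ### Duals and evaluation -/

section Dual

variable (A : Type*) [Ring A] [Algebra ℂ A]
  (E : Type*) [AddCommGroup E] [Module ℂ E] [Module A E] [Module Aᵐᵒᵖ E]
  [SMulCommClass A Aᵐᵒᵖ E] [IsScalarTower ℂ A E] [IsScalarTower ℂ Aᵐᵒᵖ E]

/-- The dual `E^*`: the right module maps from `E` to `A`. -/
def RDual : Type _ := E →ₗ[Aᵐᵒᵖ] A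

instance : AddCommGroup (RDual A E) := inferInstanceAs (AddCommGroup (E →ₗ[Aᵐᵒᵖ] A))

instance : FunLike (RDual A E) E A := inferInstanceAs (FunLike (E →ₗ[Aᵐᵒᵖ] A) E A)

instance : LinearMapClass (RDual A E) Aᵐᵒᵖ E A :=
  inferInstanceAs (LinearMapClass (E →ₗ[Aᵐᵒᵖ] A) Aᵐᵒᵖ E A)

instance : Module ℂ (RDual A E) := inferInstanceAs (Module ℂ (E →ₗ[Aᵐᵒᵖ] A))

/-- The left action `(a.α)(e) = a α(e)`. -/
instance : Module A (RDual A E) := inferInstanceAs (Module A (E →ₗ[Aᵐᵒᵖ] A))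

variable {A E}

@[ext] theorem RDual.ext {α β : RDual A E} (h : ∀ e, α e = β e) : α = β :=
  LinearMap.ext (f := (α : E →ₗ[Aᵐᵒᵖ] A)) h

@[simp] theorem RDual.add_apply (α β : RDual A E) (e : E) : (α + β) e = α e + β e := rfl
@[simp] theorem RDual.zero_apply (e : E) : (0 : RDual A E) e = 0 := rfl
@[simp] theorem RDual.smul_apply (a : A) (α : RDual A E) (e : E) : (a • α) e = a * α e := rfl
@[simp] theorem RDual.csmul_apply (c : ℂ) (α : RDual A E) (e : E) : (c • α) e = c • α e := rfl

@[simp] theorem RDual.map_op_smul (α : RDual A E) (a : A) (e : E) : α (op a • e) = α e * a := by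
  rw [map_smul]; rfl

@[simp] theorem RDual.map_csmul (α : RDual A E) (c : ℂ) (e : E) : α (c • e) = c • α e := by
  have h : c • e = (op (algebraMap ℂ A c)) • e := by
    rw [← MulOpposite.algebraMap_apply, algebraMap_smul]
  rw [h, RDual.map_op_smul, ← Algebra.commutes, ← Algebra.smul_def]

/-- The right action `(α.a)(e) = α(a.e)`. -/
def RDual.rightMul (α : RDual A E) (a : A) : RDual A E :=
  { toFun := fun e => α (a • e)
    map_add' := fun x y => by rw [smul_add, map_add]
    map_smul' := fun b e => by
      rw [smul_comm a b e, map_smul]; rfl : E →ₗ[Aᵐᵒᵖ] A }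

@[simp] theorem RDual.rightMul_apply (α : RDual A E) (a : A) (e : E) :
    α.rightMul a e = α (a • e) := rfl

instance : Module Aᵐᵒᵖ (RDual A E) where
  smul a α := α.rightMul a.unop
  one_smul α := by ext e; change α (_ • e) = _; simp
  mul_smul a b α := by
    ext e
    change α ((a * b).unop • e) = α (b.unop • a.unop • e)
    rw [unop_mul, mul_smul]
  smul_zero a := by ext e; rfl
  smul_add a α β := by ext e; rfl
  add_smul a b α := by
    ext e
    change α ((a + b).unop • e) = α (a.unop • e) + α (b.unop • e)
    rw [unop_add, add_smul, map_add]
  zero_smul α := by ext e; change α ((0 : A) • e) = 0; simp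

@[simp] theorem RDual.op_smul_apply (α : RDual A E) (a : A) (e : E) :
    (op a • α) e = α (a • e) := rfl

instance : IsScalarTower ℂ A (RDual A E) :=
  ⟨fun c a α => by ext e; simp⟩

instance : IsScalarTower ℂ Aᵐᵒᵖ (RDual A E) :=
  ⟨fun c a α => by
    ext e
    change α ((c • a).unop • e) = c • α (a.unop • e)
    rw [unop_smul, smul_assoc, RDual.map_csmul]⟩

instance : SMulCommClass A Aᵐᵒᵖ (RDual A E) := ⟨fun _ _ _ => rfl⟩

/-- `(ev ⊗ id)(α ⊗ -) : E ⊗_A F → F`, that is `e ⊗ f ↦ α(e).f`. -/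
def contract {F : Type*} [AddCommGroup F] [Module ℂ F] [Module A F] [IsScalarTower ℂ A F]
    (α : RDual A E) : BTensor A E F →ₗ[ℂ] F :=
  BTensor.lift A
    (LinearMap.mk₂ ℂ (fun e f => α e • f)
      (fun e e' f => by rw [map_add, add_smul])
      (fun c e f => by rw [RDual.map_csmul, smul_assoc])
      (fun e f f' => smul_add _ _ _)
      (fun c e f => smul_algebra_smul_comm c (α e) f))
    (fun e a f => by simp [mul_smul])

@[simp] theorem contract_bt {F : Type*} [AddCommGroup F] [Module ℂ F] [Module A F]
    [IsScalarTower ℂ A F] (α : RDual A E) (e : E) (f : F) :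
    contract α (bt A e f) = α e • f := by
  rfl

variable (A E) in
/-- The evaluation `ev : E^* ⊗_A E → A`. -/
def ev : BTensor A (RDual A E) E →ₗ[ℂ] A :=
  BTensor.lift A
    (LinearMap.mk₂ ℂ (fun α e => α e)
      (fun _ _ _ => rfl) (fun _ _ _ => rfl)
      (fun α e e' => map_add α e e') (fun c α e => RDual.map_csmul α c e))
    (fun _ _ _ => rfl)

@[simp] theorem ev_bt (α : RDual A E) (e : E) : ev A E (bt A α e) = α e := by
  rfl

variable (A E) in
/-- A (finite) dual basis of `E`: elements `e_i`, `α_i` with `e = ∑ e_i.α_i(e)` for all `e`. -/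
structure DualBasis where
  n : ℕ
  e : Fin n → E
  α : Fin n → RDual A E
  sum_eq : ∀ x : E, ∑ i, op (α i x) • e i = x

/-- The Kronecker delta `δ_E = ∑ e_i ⊗ α_i` in `E ⊗_A E^*`. -/
def DualBasis.delta (B : DualBasis A E) : BTensor A E (RDual A E) :=
  ∑ i, bt A (B.e i) (B.α i)

end Dual

/-! ### Differential calculi, connections and braidings -/

section Calculus

variable (A : Type*) [Ring A] [Algebra ℂ A]
  (Ω₁ : Type*) [AddCommGroup Ω₁] [Module ℂ Ω₁] [Module A Ω₁] [Module Aᵐᵒᵖ Ω₁]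
  [SMulCommClass A Aᵐᵒᵖ Ω₁] [IsScalarTower ℂ A Ω₁] [IsScalarTower ℂ Aᵐᵒᵖ Ω₁]
  (Ω₂ : Type*) [AddCommGroup Ω₂] [Module ℂ Ω₂] [Module A Ω₂] [Module Aᵐᵒᵖ Ω₂]
  [SMulCommClass A Aᵐᵒᵖ Ω₂] [IsScalarTower ℂ A Ω₂] [IsScalarTower ℂ Aᵐᵒᵖ Ω₂]

/-- A differential calculus on `A` in degrees at most two: `d : A → Ω¹ → Ω²`, the product
`∧ : Ω¹ ⊗_A Ω¹ → Ω²`, the graded Leibniz rule, `d² = 0`, and the generation conditions. Forms of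
degree three and more play no role for vector fields, their braiding and their Lie bracket. -/
structure Calculus where
  d₀ : A →ₗ[ℂ] Ω₁
  d₁ : Ω₁ →ₗ[ℂ] Ω₂
  wedge : BTensor A Ω₁ Ω₁ →ₗ[ℂ] Ω₂
  wedge_smul : ∀ (a : A) t, wedge (a • t) = a • wedge t
  wedge_op_smul : ∀ (a : A) t, wedge (op a • t) = op a • wedge t
  d₀_mul : ∀ a b : A, d₀ (a * b) = op b • d₀ a + a • d₀ b
  d₁_smul : ∀ (a : A) (ω : Ω₁), d₁ (a • ω) = wedge (bt A (d₀ a) ω) + a • d₁ ω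
  d₁_op_smul : ∀ (a : A) (ω : Ω₁), d₁ (op a • ω) = op a • d₁ ω - wedge (bt A ω (d₀ a))
  d₁_d₀ : ∀ a : A, d₁ (d₀ a) = 0
  span_left₁ : Submodule.span ℂ {ω | ∃ a b : A, ω = a • d₀ b} = ⊤
  span_right₁ : Submodule.span ℂ {ω | ∃ a b : A, ω = op b • d₀ a} = ⊤
  span_left₂ : Submodule.span ℂ {ω | ∃ (a : A) (η : Ω₁), ω = a • d₁ η} = ⊤
  span_right₂ : Submodule.span ℂ {ω | ∃ (a : A) (η : Ω₁), ω = op a • d₁ η} = ⊤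

variable {A Ω₁ Ω₂}

/-- The products span the two-forms: a consequence of the Leibniz rule and generation. -/
theorem Calculus.wedge_surjective (C : Calculus A Ω₁ Ω₂) : Function.Surjective C.wedge := by
  rw [← LinearMap.range_eq_top, eq_top_iff, ← C.span_left₂, Submodule.span_le]
  rintro _ ⟨a, η, rfl⟩
  have key : ∀ η : Ω₁, C.d₁ η ∈ LinearMap.range C.wedge := by
    intro η
    have h : η ∈ Submodule.span ℂ {ω | ∃ a b : A, ω = a • C.d₀ b} := by
      rw [C.span_left₁]; trivial
    induction h using Submodule.span_induction with
    | mem x hx =>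
      obtain ⟨a, b, rfl⟩ := hx
      rw [C.d₁_smul, C.d₁_d₀, smul_zero, add_zero]
      exact ⟨_, rfl⟩
    | zero => simp
    | add x y _ _ hx hy => rw [map_add]; exact Submodule.add_mem _ hx hy
    | smul c x _ hx => rw [map_smul]; exact Submodule.smul_mem _ c hx
  obtain ⟨t, ht⟩ := key η
  exact ⟨a • t, by rw [C.wedge_smul, ht]⟩

/-- A bimodule covariant derivative `(∇, σ)` on the bimodule `E`: a left covariant derivative `∇`
and a bimodule map `σ : E ⊗_A Ω¹ → Ω¹ ⊗_A E` with `∇(e.a) = ∇(e).a + σ(e ⊗ da)`. -/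
structure BimoduleConnection (C : Calculus A Ω₁ Ω₂) (E : Type*) [AddCommGroup E] [Module ℂ E]
    [Module A E] [Module Aᵐᵒᵖ E] [SMulCommClass A Aᵐᵒᵖ E] [IsScalarTower ℂ A E]
    [IsScalarTower ℂ Aᵐᵒᵖ E] where
  nabla : E →ₗ[ℂ] BTensor A Ω₁ E
  nabla_smul : ∀ (a : A) (e : E), nabla (a • e) = bt A (C.d₀ a) e + a • nabla e
  σ : BTensor A E Ω₁ →ₗ[ℂ] BTensor A Ω₁ E
  σ_smul : ∀ (a : A) t, σ (a • t) = a • σ t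
  σ_op_smul : ∀ (a : A) t, σ (op a • t) = op a • σ t
  nabla_op_smul : ∀ (a : A) (e : E), nabla (op a • e) = op a • nabla e + σ (bt A e (C.d₀ a))

section DualBraiding

variable {C : Calculus A Ω₁ Ω₂} {E : Type*} [AddCommGroup E] [Module ℂ E]
  [Module A E] [Module Aᵐᵒᵖ E] [SMulCommClass A Aᵐᵒᵖ E] [IsScalarTower ℂ A E]
  [IsScalarTower ℂ Aᵐᵒᵖ E]

/-- The inverse braiding `σ⁻¹ : Ω¹ ⊗_A E → E ⊗_A Ω¹`. -/
def BimoduleConnection.sigmaInv (D : BimoduleConnection C E) (hσ : Function.Bijective D.σ) :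
    BTensor A Ω₁ E →ₗ[ℂ] BTensor A E Ω₁ :=
  (LinearEquiv.ofBijective D.σ hσ).symm

theorem BimoduleConnection.sigmaInv_smul (D : BimoduleConnection C E)
    (hσ : Function.Bijective D.σ) (a : A) (t : BTensor A Ω₁ E) :
    D.sigmaInv hσ (a • t) = a • D.sigmaInv hσ t := by
  apply hσ.1
  have h : ∀ s, D.σ (D.sigmaInv hσ s) = s := (LinearEquiv.ofBijective D.σ hσ).apply_symm_apply
  rw [D.σ_smul, h, h]

theorem contract_smul {F : Type*} [AddCommGroup F] [Module ℂ F] [Module A F] [Module Aᵐᵒᵖ F]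
    [SMulCommClass A Aᵐᵒᵖ F] [IsScalarTower ℂ A F] [IsScalarTower ℂ Aᵐᵒᵖ F]
    (α : RDual A E) (a : A) (t : BTensor A E F) : contract α (a • t) = contract (op a • α) t := by
  change ((contract α).comp (BTensor.leftAct A E F a)) t = _
  congr 1
  apply BTensor.ext
  intros
  simp

/-- The braiding `σ_{E^*} : E^* ⊗_A Ω¹ → Ω¹ ⊗_A E^*`,
`σ_{E^*}(α ⊗ ξ) = ∑ (ev ⊗ id)(id ⊗ σ_E⁻¹)(α ⊗ ξ ⊗ e_i) ⊗ α_i`. -/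
def BimoduleConnection.dualBraiding (D : BimoduleConnection C E)
    (hσ : Function.Bijective D.σ) (B : DualBasis A E) :
    BTensor A (RDual A E) Ω₁ →ₗ[ℂ] BTensor A Ω₁ (RDual A E) :=
  BTensor.lift A
    (LinearMap.mk₂ ℂ
      (fun α ξ => ∑ i, bt A (contract α (D.sigmaInv hσ (bt A ξ (B.e i)))) (B.α i))
      (fun α β ξ => by
        rw [← Finset.sum_add_distrib]
        refine Finset.sum_congr rfl fun i _ => ?_
        have h : ∀ t : BTensor A E Ω₁, contract (α + β) t = contract α t + contract β t := by
          intro t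
          rw [← LinearMap.add_apply]
          congr 1
          apply BTensor.ext
          intros
          simp [add_smul]
        rw [h, add_bt])
      (fun c α ξ => by
        rw [Finset.smul_sum]
        refine Finset.sum_congr rfl fun i _ => ?_
        have h : ∀ t : BTensor A E Ω₁, contract (c • α) t = c • contract α t := by
          intro t
          rw [← LinearMap.smul_apply]
          congr 1
          apply BTensor.ext
          intros
          simp
        rw [h, csmul_bt])
      (fun α ξ η => by
        rw [← Finset.sum_add_distrib]
        refine Finset.sum_congr rfl fun i _ => ?_
        rw [add_bt, map_add, map_add, add_bt])
      (fun c α ξ => by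
        rw [Finset.smul_sum]
        refine Finset.sum_congr rfl fun i _ => ?_
        rw [csmul_bt, map_smul, map_smul, csmul_bt]))
    (fun α a ξ => by
      simp only [LinearMap.mk₂_apply]
      refine Finset.sum_congr rfl fun i _ => ?_
      rw [← contract_smul, ← D.sigmaInv_smul, smul_bt])

@[simp] theorem BimoduleConnection.dualBraiding_bt (D : BimoduleConnection C E)
    (hσ : Function.Bijective D.σ) (B : DualBasis A E) (α : RDual A E) (ξ : Ω₁) :
    D.dualBraiding hσ B (bt A α ξ)
      = ∑ i, bt A (contract α (D.sigmaInv hσ (bt A ξ (B.e i)))) (B.α i) := by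
  simp [BimoduleConnection.dualBraiding]

end DualBraiding

/-! ### Vector fields -/

variable (A Ω₁) in
/-- The vector fields `Vec = (Ω¹)^*`. -/
abbrev Vec : Type _ := RDual A Ω₁

/-- The differential dimension `ev(σ⁻¹ δ)`, where `δ = ∑ ξ_i ⊗ X_i` in `Ω¹ ⊗_A Vec` and `σ⁻¹` is
the inverse of the braiding `Vec ⊗_A Ω¹ → Ω¹ ⊗_A Vec`. -/
def diffDim {C : Calculus A Ω₁ Ω₂} (D : BimoduleConnection C Ω₁)
    (hσ : Function.Bijective D.σ) (B : DualBasis A Ω₁)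
    (hV : Function.Bijective (D.dualBraiding hσ B)) : A :=
  ev A Ω₁ ((LinearEquiv.ofBijective (D.dualBraiding hσ B) hV).symm B.delta)

variable (A Ω₁) in
/-- `X ⊗ Y ↦ ev(id ⊗ ev ⊗ id)(X ⊗ Y ⊗ -)`, that is `ξ ⊗ η ↦ X(Y(ξ).η)`. It kills the differences
`X.a ⊗ Y - X ⊗ a.Y`, so that it factors through `Vec ⊗_A Vec`. -/
def pairing : Vec A Ω₁ ⊗[ℂ] Vec A Ω₁ →ₗ[ℂ] BTensor A Ω₁ Ω₁ →ₗ[ℂ] A :=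
  TensorProduct.lift <| LinearMap.mk₂ ℂ
    (fun X Y =>
      ({ toFun := X, map_add' := map_add X, map_smul' := fun c e => RDual.map_csmul X c e } :
        Ω₁ →ₗ[ℂ] A).comp (contract Y))
    (fun X X' Y => by ext t; rfl)
    (fun c X Y => by ext t; rfl)
    (fun X Y Y' => by
      apply BTensor.ext
      intro ξ η
      simp [add_smul])
    (fun c X Y => by
      apply BTensor.ext
      intro ξ η
      simp)

@[simp] theorem pairing_tmul (X Y : Vec A Ω₁) (t : BTensor A Ω₁ Ω₁) :
    pairing A Ω₁ (X ⊗ₜ Y) t = X (contract Y t) := rfl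

namespace Calculus

/-- The antisymmetric elements `A²` of `Vec ⊗ Vec`: those whose pairing with `Θ² = ker ∧`
vanishes. -/
def antisymm (C : Calculus A Ω₁ Ω₂) : Submodule ℂ (Vec A Ω₁ ⊗[ℂ] Vec A Ω₁) where
  carrier := {x | ∀ k : BTensor A Ω₁ Ω₁, C.wedge k = 0 → pairing A Ω₁ x k = 0}
  add_mem' hx hy k hk := by simp [hx k hk, hy k hk]
  zero_mem' k _ := by simp
  smul_mem' c x hx k hk := by simp [hx k hk]

/-- The directional derivative `D_X(a) = X(da)`. -/
def dirDeriv (C : Calculus A Ω₁ Ω₂) (X : Vec A Ω₁) (a : A) : A := X (C.d₀ a)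

/-- The linear extension of `X ⊗ Y ↦ D_X(Y(ξ))`. -/
def derivPart (C : Calculus A Ω₁ Ω₂) (ξ : Ω₁) : Vec A Ω₁ ⊗[ℂ] Vec A Ω₁ →ₗ[ℂ] A :=
  TensorProduct.lift <| LinearMap.mk₂ ℂ (fun X Y => C.dirDeriv X (Y ξ))
    (fun _ _ _ => rfl) (fun _ _ _ => rfl)
    (fun X Y Y' => by simp [dirDeriv])
    (fun c X Y => by simp [dirDeriv])

@[simp] theorem derivPart_tmul (C : Calculus A Ω₁ Ω₂) (ξ : Ω₁) (X Y : Vec A Ω₁) :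
    C.derivPart ξ (X ⊗ₜ Y) = X (C.d₀ (Y ξ)) := rfl

/-- A choice of `z` with `∧ z = dξ`. -/
def liftD (C : Calculus A Ω₁ Ω₂) (ξ : Ω₁) : BTensor A Ω₁ Ω₁ :=
  (C.wedge_surjective (C.d₁ ξ)).choose

theorem wedge_liftD (C : Calculus A Ω₁ Ω₂) (ξ : Ω₁) : C.wedge (C.liftD ξ) = C.d₁ ξ :=
  (C.wedge_surjective (C.d₁ ξ)).choose_spec

/-- The choice of `z` does not matter. -/
theorem pairing_liftD (C : Calculus A Ω₁ Ω₂) (x : C.antisymm) (ξ : Ω₁) (z : BTensor A Ω₁ Ω₁)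
    (hz : C.wedge z = C.d₁ ξ) : pairing A Ω₁ x (C.liftD ξ) = pairing A Ω₁ x z := by
  rw [← sub_eq_zero, ← map_sub]
  exact x.2 _ (by rw [map_sub, hz, wedge_liftD, sub_self])

theorem pairing_op_smul (x : Vec A Ω₁ ⊗[ℂ] Vec A Ω₁) (a : A) (t : BTensor A Ω₁ Ω₁) :
    pairing A Ω₁ x (op a • t) = pairing A Ω₁ x t * a := by
  induction x using TensorProduct.induction_on with
  | zero => simp
  | add x y hx hy => simp [hx, hy, add_mul]
  | tmul X Y =>
    have h : contract Y (op a • t) = op a • contract (F := Ω₁) Y t := by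
      change ((contract Y).comp (BTensor.rightAct A Ω₁ Ω₁ (op a))) t
        = ((Algebra.lsmul ℂ ℂ Ω₁ (op a)).comp (contract Y)) t
      congr 1
      apply BTensor.ext
      intro ξ η
      simp [smul_comm (Y ξ) (op a) η]
    rw [pairing_tmul, pairing_tmul, h, RDual.map_op_smul]

theorem derivPart_op_smul (C : Calculus A Ω₁ Ω₂) (x : Vec A Ω₁ ⊗[ℂ] Vec A Ω₁) (a : A) (ξ : Ω₁) :
    C.derivPart (op a • ξ) x = C.derivPart ξ x * a + pairing A Ω₁ x (bt A ξ (C.d₀ a)) := by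
  induction x using TensorProduct.induction_on with
  | zero => simp
  | add x y hx hy => simp only [map_add, hx, hy, LinearMap.add_apply, add_mul]; abel
  | tmul X Y => simp [C.d₀_mul]

/-- The Lie bracket `φ : A² → Vec`,
`φ(X ⊗ Y)(ξ) = D_X(Y(ξ)) + ev(id ⊗ ev ⊗ id)(X ⊗ Y ⊗ z)` with `∧ z = dξ`. -/
def bracket (C : Calculus A Ω₁ Ω₂) (x : C.antisymm) : Vec A Ω₁ :=
  { toFun := fun ξ => C.derivPart ξ x + pairing A Ω₁ x (C.liftD ξ)
    map_add' := fun ξ η => by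
      rw [C.pairing_liftD x (ξ + η) (C.liftD ξ + C.liftD η)
        (by rw [map_add, map_add, wedge_liftD, wedge_liftD])]
      have h : C.derivPart (ξ + η) x = C.derivPart ξ x + C.derivPart η x := by
        rw [← LinearMap.add_apply]
        congr 1
        ext X Y
        simp
      rw [h, map_add]
      abel
    map_smul' := fun a ξ => by
      obtain ⟨a, rfl⟩ := op_surjective a
      rw [C.pairing_liftD x (op a • ξ) (op a • C.liftD ξ - bt A ξ (C.d₀ a))
        (by rw [map_sub, C.wedge_op_smul, wedge_liftD, C.d₁_op_smul]),
        derivPart_op_smul, map_sub, pairing_op_smul, RingHom.id_apply, op_smul_eq_mul, add_mul]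
      abel : Ω₁ →ₗ[Aᵐᵒᵖ] A }

theorem bracket_apply (C : Calculus A Ω₁ Ω₂) (x : C.antisymm) (ξ : Ω₁) (z : BTensor A Ω₁ Ω₁)
    (hz : C.wedge z = C.d₁ ξ) :
    C.bracket x ξ = C.derivPart ξ x + pairing A Ω₁ x z := by
  rw [← C.pairing_liftD x ξ z hz]
  rfl

end Calculus

end Calculus

/-! ### Free right modules with twisted left action -/

section Twisted

variable {A : Type*} [Ring A] [Algebra ℂ A]

/-- The bimodule which is free as a right module on a basis `(b_i)`, with `a.b_i = b_i.θ(a)`.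
The function `f` stands for `∑ b_i.(f i)`. -/
def Twisted (ι : Type) (_θ : A →ₐ[ℂ] A) : Type _ := ι → A

variable (ι : Type) (θ : A →ₐ[ℂ] A)

instance : AddCommGroup (Twisted ι θ) := inferInstanceAs (AddCommGroup (ι → A))
instance : Module ℂ (Twisted ι θ) := inferInstanceAs (Module ℂ (ι → A))
instance : Module Aᵐᵒᵖ (Twisted ι θ) := inferInstanceAs (Module Aᵐᵒᵖ (ι → A))
instance : Module A (Twisted ι θ) := Module.compHom (ι → A) θ.toRingHom
instance : FunLike (Twisted ι θ) ι A := ⟨id, fun _ _ h => h⟩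

variable {ι θ}

/-- The element `∑ b_i.(f i)`. -/
def Twisted.of (f : ι → A) : Twisted ι θ := f

@[simp] theorem Twisted.of_apply (f : ι → A) (i : ι) : (Twisted.of f : Twisted ι θ) i = f i := rfl

@[ext] theorem Twisted.ext {f g : Twisted ι θ} (h : ∀ i, f i = g i) : f = g := funext h
@[simp] theorem Twisted.add_apply (f g : Twisted ι θ) (i : ι) : (f + g) i = f i + g i := rfl
@[simp] theorem Twisted.sub_apply (f g : Twisted ι θ) (i : ι) : (f - g) i = f i - g i := rfl
@[simp] theorem Twisted.neg_apply (f : Twisted ι θ) (i : ι) : (-f) i = -f i := rfl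
@[simp] theorem Twisted.zero_apply (i : ι) : (0 : Twisted ι θ) i = 0 := rfl
@[simp] theorem Twisted.csmul_apply (c : ℂ) (f : Twisted ι θ) (i : ι) :
    (c • f) i = c • f i := rfl
@[simp] theorem Twisted.smul_apply (a : A) (f : Twisted ι θ) (i : ι) :
    (a • f) i = θ a * f i := rfl
@[simp] theorem Twisted.op_smul_apply (a : A) (f : Twisted ι θ) (i : ι) :
    (op a • f) i = f i * a := rfl

instance : IsScalarTower ℂ A (Twisted ι θ) := ⟨fun c a f => by ext i; simp⟩
instance : IsScalarTower ℂ Aᵐᵒᵖ (Twisted ι θ) := ⟨fun c a f => by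
  obtain ⟨a, rfl⟩ := op_surjective a
  ext i
  change f i * (c • a) = c • (f i * a)
  rw [mul_smul_comm]⟩
instance : SMulCommClass A Aᵐᵒᵖ (Twisted ι θ) := ⟨fun a b f => by
  obtain ⟨b, rfl⟩ := op_surjective b
  ext i
  simp [mul_assoc]⟩

variable (θ) in
/-- The basis element `b_i`. -/
def Twisted.basis [DecidableEq ι] (i : ι) : Twisted ι θ := Pi.single i (1 : A)

theorem Twisted.basis_apply [DecidableEq ι] (i j : ι) :
    Twisted.basis θ i j = if j = i then (1 : A) else 0 := by
  exact Pi.single_apply i (1 : A) j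

end Twisted

/-! ### The deformed sphere in the stereographic chart -/

/-- Generators: `z`, `z̄` and the inverse `w` of `1 + z̄ z`. -/
inductive SphereGen
  | z | zbar | w

section SphereRel

open FreeAlgebra SphereGen

/-- The relations `z z̄ = q⁻² z̄ z + q⁻² - 1` and `w (z̄ z + 1) = 1 = (z̄ z + 1) w`. -/
inductive SphereRel (q : ℂˣ) : FreeAlgebra ℂ SphereGen → FreeAlgebra ℂ SphereGen → Prop
  | comm : SphereRel q (ι ℂ z * ι ℂ zbar)
      (((q : ℂ)⁻¹ ^ 2) • (ι ℂ zbar * ι ℂ z) + algebraMap ℂ _ ((q : ℂ)⁻¹ ^ 2 - 1))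
  | left_inv : SphereRel q (ι ℂ w * (ι ℂ zbar * ι ℂ z + 1)) 1
  | right_inv : SphereRel q ((ι ℂ zbar * ι ℂ z + 1) * ι ℂ w) 1

end SphereRel

/-- The algebra `S²_q`: generated by `z`, `z̄` with `z z̄ = q⁻² z̄ z + q⁻² - 1`, and with
`R + 1 = z̄ z + 1` made invertible. -/
def Sphere (q : ℂˣ) : Type := RingQuot (SphereRel q)

namespace Sphere

variable (q : ℂˣ)

instance : Ring (Sphere q) := inferInstanceAs (Ring (RingQuot (SphereRel q)))
instance : Algebra ℂ (Sphere q) := inferInstanceAs (Algebra ℂ (RingQuot (SphereRel q)))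

/-- The quotient map from the free algebra. -/
def mk : FreeAlgebra ℂ SphereGen →ₐ[ℂ] Sphere q := RingQuot.mkAlgHom ℂ (SphereRel q)

theorem mk_surjective : Function.Surjective (mk q) :=
  RingQuot.mkAlgHom_surjective ℂ (SphereRel q)

/-- The generator `z`. -/
def z : Sphere q := mk q (FreeAlgebra.ι ℂ SphereGen.z)
/-- The generator `z̄`. -/
def zbar : Sphere q := mk q (FreeAlgebra.ι ℂ SphereGen.zbar)
/-- The element `(R + 1)⁻¹`, where `R = z̄ z`. -/
def w : Sphere q := mk q (FreeAlgebra.ι ℂ SphereGen.w)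

theorem z_mul_zbar :
    z q * zbar q = ((q : ℂ)⁻¹ ^ 2) • (zbar q * z q) + algebraMap ℂ _ ((q : ℂ)⁻¹ ^ 2 - 1) := by
  have h := RingQuot.mkAlgHom_rel ℂ (SphereRel.comm (q := q))
  have h' : mk q _ = mk q _ := h
  simp only [map_mul, map_add, map_smul, AlgHom.commutes] at h'
  exact h'

theorem w_mul : w q * (zbar q * z q + 1) = 1 := by
  have h := RingQuot.mkAlgHom_rel ℂ (SphereRel.left_inv (q := q))
  have h' : mk q _ = mk q _ := h
  simp only [map_mul, map_add, map_one] at h'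
  exact h'

theorem mul_w : (zbar q * z q + 1) * w q = 1 := by
  have h := RingQuot.mkAlgHom_rel ℂ (SphereRel.right_inv (q := q))
  have h' : mk q _ = mk q _ := h
  simp only [map_mul, map_add, map_one] at h'
  exact h'

variable {q}

/-- The universal property of `S²_q`. -/
def lift {B : Type*} [Ring B] [Algebra ℂ B] (a b c : B)
    (h₁ : a * b = ((q : ℂ)⁻¹ ^ 2) • (b * a) + algebraMap ℂ _ ((q : ℂ)⁻¹ ^ 2 - 1))
    (h₂ : c * (b * a + 1) = 1) (h₃ : (b * a + 1) * c = 1) : Sphere q →ₐ[ℂ] B :=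
  RingQuot.liftAlgHom ℂ ⟨FreeAlgebra.lift ℂ (fun g : SphereGen => match g with
    | .z => a
    | .zbar => b
    | .w => c), by
      intro x y h
      cases h with
      | comm =>
        simp only [map_mul, map_add, map_smul, AlgHom.commutes, FreeAlgebra.lift_ι_apply]
        exact h₁
      | left_inv =>
        simp only [map_mul, map_add, map_one, FreeAlgebra.lift_ι_apply]
        exact h₂
      | right_inv =>
        simp only [map_mul, map_add, map_one, FreeAlgebra.lift_ι_apply]
        exact h₃⟩

section

variable {B : Type*} [Ring B] [Algebra ℂ B] (a b c : B)
    (h₁ : a * b = ((q : ℂ)⁻¹ ^ 2) • (b * a) + algebraMap ℂ _ ((q : ℂ)⁻¹ ^ 2 - 1))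
    (h₂ : c * (b * a + 1) = 1) (h₃ : (b * a + 1) * c = 1)

@[simp] theorem lift_z : lift a b c h₁ h₂ h₃ (z q) = a := by
  simp only [lift, z, mk]
  erw [RingQuot.liftAlgHom_mkAlgHom_apply]
  simp

@[simp] theorem lift_zbar : lift a b c h₁ h₂ h₃ (zbar q) = b := by
  simp only [lift, zbar, mk]
  erw [RingQuot.liftAlgHom_mkAlgHom_apply]
  simp

@[simp] theorem lift_w : lift a b c h₁ h₂ h₃ (w q) = c := by
  simp only [lift, w, mk]
  erw [RingQuot.liftAlgHom_mkAlgHom_apply]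
  simp

end

/-- Induction on elements of `S²_q`. -/
theorem induction {P : Sphere q → Prop} (halg : ∀ c : ℂ, P (algebraMap ℂ _ c))
    (hz : P (z q)) (hzbar : P (zbar q)) (hw : P (w q))
    (hadd : ∀ a b, P a → P b → P (a + b)) (hmul : ∀ a b, P a → P b → P (a * b))
    (a : Sphere q) : P a := by
  obtain ⟨x, rfl⟩ := mk_surjective q a
  induction x using FreeAlgebra.induction with
  | grade0 c => rw [AlgHom.commutes]; exact halg c
  | grade1 g => cases g with
    | z => exact hz
    | zbar => exact hzbar
    | w => exact hw
  | mul x y hx hy => rw [map_mul]; exact hmul _ _ hx hy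
  | add x y hx hy => rw [map_add]; exact hadd _ _ hx hy

variable (q) in
/-- The automorphism `z ↦ t z`, `z̄ ↦ t⁻¹ z̄`. -/
def rot (t : ℂˣ) : Sphere q →ₐ[ℂ] Sphere q :=
  lift ((t : ℂ) • z q) ((t : ℂ)⁻¹ • zbar q) (w q)
    (by simp only [smul_mul_smul_comm]; simp [z_mul_zbar])
    (by simp only [smul_mul_smul_comm]; simp [w_mul])
    (by simp only [smul_mul_smul_comm]; simp [mul_w])

@[simp] theorem rot_z (t : ℂˣ) : rot q t (z q) = (t : ℂ) • z q := lift_z ..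
@[simp] theorem rot_zbar (t : ℂˣ) : rot q t (zbar q) = (t : ℂ)⁻¹ • zbar q := lift_zbar ..
@[simp] theorem rot_w (t : ℂˣ) : rot q t (w q) = w q := lift_w ..

theorem rot_rot_inv (t : ℂˣ) (a : Sphere q) : rot q t (rot q t⁻¹ a) = a := by
  induction a using Sphere.induction with
  | halg c => simp
  | hz => simp
  | hzbar => simp
  | hw => simp
  | hadd a b ha hb => simp [ha, hb]
  | hmul a b ha hb => simp [ha, hb]

variable (q) in
/-- The twist of the one-forms, `z ↦ q⁻² z`, `z̄ ↦ q² z̄`. -/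
abbrev θ : Sphere q →ₐ[ℂ] Sphere q := rot q (q⁻¹ ^ 2)

variable (q) in
/-- The one-forms: free as a right module on `dz`, `dz̄`, with `z.dz = q⁻² dz.z`,
`z.dz̄ = q⁻² dz̄.z`, `z̄.dz = q² dz.z̄`, `z̄.dz̄ = q² dz̄.z̄`. -/
abbrev Ω₁ : Type := Twisted (Fin 2) (θ q)

variable (q) in
/-- The two-forms: free as a right module on `dz ∧ dz̄`. -/
abbrev Ω₂ : Type := Twisted (Fin 1) ((θ q).comp (θ q))

variable (q) in
/-- `dz i` is `dz` for `i = 0` and `dz̄` for `i = 1`. -/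
def dz (i : Fin 2) : Ω₁ q := Twisted.basis (θ q) i

@[simp] theorem dz_zero_zero : dz q 0 0 = 1 := by simp [dz, Twisted.basis_apply]
@[simp] theorem dz_zero_one : dz q 0 1 = 0 := by simp [dz, Twisted.basis_apply]
@[simp] theorem dz_one_zero : dz q 1 0 = 0 := by simp [dz, Twisted.basis_apply]
@[simp] theorem dz_one_one : dz q 1 1 = 1 := by simp [dz, Twisted.basis_apply]

theorem z_smul_dz (i : Fin 2) : z q • dz q i = ((q : ℂ)⁻¹ ^ 2) • (op (z q) • dz q i) := by
  ext j; fin_cases i <;> fin_cases j <;> simp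

theorem zbar_smul_dz (i : Fin 2) : zbar q • dz q i = ((q : ℂ) ^ 2) • (op (zbar q) • dz q i) := by
  ext j; fin_cases i <;> fin_cases j <;> simp

/-- The product of one-forms, fixed by `dz ∧ dz = dz̄ ∧ dz̄ = 0` and
`dz̄ ∧ dz = -q² dz ∧ dz̄`. -/
def wedge : BTensor (Sphere q) (Ω₁ q) (Ω₁ q) →ₗ[ℂ] Ω₂ q :=
  BTensor.lift (Sphere q)
    (LinearMap.mk₂ ℂ
      (fun f g => Twisted.of fun _ => θ q (f 0) * g 1 - ((q : ℂ) ^ 2) • (θ q (f 1) * g 0))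
      (fun f f' g => by
        ext
        simp only [Twisted.of_apply, Twisted.add_apply, map_add, add_mul, smul_add]
        abel)
      (fun c f g => by
        ext
        simp only [Twisted.of_apply, Twisted.csmul_apply, map_smul, smul_mul_assoc, smul_sub,
          smul_comm c])
      (fun f g g' => by
        ext
        simp only [Twisted.of_apply, Twisted.add_apply, mul_add, smul_add]
        abel)
      (fun c f g => by
        ext
        simp only [Twisted.of_apply, Twisted.csmul_apply, mul_smul_comm, smul_sub, smul_comm c]))
    (fun f a g => by
      ext
      simp only [LinearMap.mk₂_apply, Twisted.of_apply, Twisted.op_smul_apply, Twisted.smul_apply,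
        map_mul, mul_assoc])

theorem wedge_bt (f g : Ω₁ q) (i : Fin 1) :
    wedge (bt (Sphere q) f g) i = θ q (f 0) * g 1 - ((q : ℂ) ^ 2) • (θ q (f 1) * g 0) := rfl

theorem wedge_dz_dzbar :
    wedge (bt (Sphere q) (dz q 0) (dz q 1)) = Twisted.basis ((θ q).comp (θ q)) 0 := by
  ext i; fin_cases i; simp [wedge_bt, Twisted.basis_apply]

theorem wedge_dzbar_dz :
    wedge (bt (Sphere q) (dz q 1) (dz q 0))
      = -(((q : ℂ) ^ 2) • wedge (bt (Sphere q) (dz q 0) (dz q 1))) := by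
  ext i; simp [wedge_bt]

theorem wedge_dz_self (i : Fin 2) : wedge (bt (Sphere q) (dz q i) (dz q i)) = 0 := by
  ext j; fin_cases i <;> simp [wedge_bt]

section Differential

open TrivSqZeroExt

/-- `c - c.m.c` is the inverse of `s + m` in a square-zero extension if `c` is that of `s`. -/
theorem tsze_inv {A M : Type*} [Ring A] [AddCommGroup M] [Module A M] [Module Aᵐᵒᵖ M]
    [SMulCommClass A Aᵐᵒᵖ M] {c s : A} (m : M) (h : c * s = 1) (h' : s * c = 1) :
    (inl c - inr (op c • c • m)) * (inl s + inr m) = (1 : TrivSqZeroExt A M) ∧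
      (inl s + inr m) * (inl c - inr (op c • c • m)) = (1 : TrivSqZeroExt A M) := by
  constructor
  · apply TrivSqZeroExt.ext
    · simp [h]
    · simp [← mul_smul, ← op_mul, h]
  · apply TrivSqZeroExt.ext
    · simp [h']
    · simp [smul_comm s (op c), ← mul_smul, h']

theorem total_S : (inl (zbar q) + inr (dz q 1)) * (inl (z q) + inr (dz q 0)) + 1
    = (inl (zbar q * z q + 1) + inr (op (z q) • dz q 1 + zbar q • dz q 0) :
      TrivSqZeroExt (Sphere q) (Ω₁ q)) := by
  apply TrivSqZeroExt.ext
  · simp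
  · simp [add_comm]

/-- The homomorphism `a ↦ a + da` into the square-zero extension of the algebra by the one-forms,
fixed by `z ↦ z + dz` and `z̄ ↦ z̄ + dz̄`. -/
def totalHom : Sphere q →ₐ[ℂ] TrivSqZeroExt (Sphere q) (Ω₁ q) :=
  lift (inl (z q) + inr (dz q 0)) (inl (zbar q) + inr (dz q 1))
    (inl (w q) - inr (op (w q) • w q • (op (z q) • dz q 1 + zbar q • dz q 0)))
    (by
      have h : ∀ c : ℂ, algebraMap ℂ (TrivSqZeroExt (Sphere q) (Ω₁ q)) c
        = inl (algebraMap ℂ _ c) := fun _ => rfl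
      apply TrivSqZeroExt.ext
      · simp [z_mul_zbar, h]
      · simp [h, z_smul_dz, zbar_smul_dz, add_comm])
    (by rw [total_S]; exact (tsze_inv _ (w_mul q) (mul_w q)).1)
    (by rw [total_S]; exact (tsze_inv _ (w_mul q) (mul_w q)).2)

theorem fst_totalHom (a : Sphere q) : (totalHom a).fst = a := by
  induction a using Sphere.induction with
  | halg c => rw [AlgHom.commutes]; rfl
  | hz => simp [totalHom]
  | hzbar => simp [totalHom]
  | hw => simp [totalHom]
  | hadd a b ha hb => simp [ha, hb]
  | hmul a b ha hb => simp [ha, hb]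

/-- The differential `d : S²_q → Ω¹`. -/
def d₀ : Sphere q →ₗ[ℂ] Ω₁ q where
  toFun a := (totalHom a).snd
  map_add' a b := by simp
  map_smul' c a := by simp

theorem d₀_mul (a b : Sphere q) : d₀ (a * b) = op b • d₀ a + a • d₀ b := by
  simp [d₀, fst_totalHom, add_comm]

@[simp] theorem d₀_z : d₀ (z q) = dz q 0 := by simp [d₀, totalHom]

@[simp] theorem d₀_zbar : d₀ (zbar q) = dz q 1 := by simp [d₀, totalHom]

@[simp] theorem d₀_algebraMap (c : ℂ) : d₀ (algebraMap ℂ (Sphere q) c) = 0 := by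
  change (totalHom _).snd = 0
  rw [AlgHom.commutes]
  rfl

@[simp] theorem d₀_one : d₀ (1 : Sphere q) = 0 := by
  simpa using d₀_algebraMap (q := q) 1

theorem d₀_w : d₀ (w q) = -(op (w q) • w q • (op (z q) • dz q 1 + zbar q • dz q 0)) := by
  simp [d₀, totalHom]

end Differential

theorem d₀_rot (a : Sphere q) :
    d₀ (θ q a) 0 = ((q : ℂ)⁻¹ ^ 2) • θ q (d₀ a 0) ∧
      d₀ (θ q a) 1 = ((q : ℂ) ^ 2) • θ q (d₀ a 1) := by
  induction a using Sphere.induction with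
  | halg c => simp
  | hz => simp
  | hzbar => simp
  | hw => simp [d₀_w, mul_assoc]
  | hadd a b ha hb => simp [ha.1, ha.2, hb.1, hb.2]
  | hmul a b ha hb => simp [d₀_mul, ha.1, ha.2, hb.1, hb.2]

/-- The differential `d : Ω¹ → Ω²`, `d(dz.a + dz̄.b) = -dz ∧ da - dz̄ ∧ db`. -/
def d₁ : Ω₁ q →ₗ[ℂ] Ω₂ q where
  toFun f := -wedge (bt _ (dz q 0) (d₀ (f 0))) - wedge (bt _ (dz q 1) (d₀ (f 1)))
  map_add' f g := by
    simp only [Twisted.add_apply, map_add, bt_add]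
    abel
  map_smul' c f := by
    simp only [Twisted.csmul_apply, map_smul, bt_csmul, RingHom.id_apply, smul_sub, smul_neg]

theorem d₁_apply (f : Ω₁ q) (i : Fin 1) :
    d₁ f i = -d₀ (f 0) 1 + ((q : ℂ) ^ 2) • d₀ (f 1) 0 := by
  simp [d₁, wedge_bt]

theorem wedge_smul (a : Sphere q) (t : BTensor (Sphere q) (Ω₁ q) (Ω₁ q)) :
    wedge (a • t) = a • wedge t := by
  change (wedge.comp (BTensor.leftAct _ _ _ a)) t = ((Algebra.lsmul ℂ ℂ (Ω₂ q) a).comp wedge) t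
  congr 1
  apply BTensor.ext
  intro f g
  ext i
  simp [wedge_bt, mul_sub, mul_assoc]

theorem wedge_op_smul (a : Sphere q) (t : BTensor (Sphere q) (Ω₁ q) (Ω₁ q)) :
    wedge (op a • t) = op a • wedge t := by
  change (wedge.comp (BTensor.rightAct _ _ _ (op a))) t
    = ((Algebra.lsmul ℂ ℂ (Ω₂ q) (op a)).comp wedge) t
  congr 1
  apply BTensor.ext
  intro f g
  ext i
  simp [wedge_bt, sub_mul, mul_assoc]

theorem d₁_smul (a : Sphere q) (f : Ω₁ q) :
    d₁ (a • f) = wedge (bt _ (d₀ a) f) + a • d₁ f := by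
  ext i
  simp only [d₁_apply, wedge_bt, Twisted.add_apply, Twisted.smul_apply, d₀_mul,
    Twisted.op_smul_apply, (d₀_rot a).1, (d₀_rot a).2, AlgHom.comp_apply, mul_add, mul_neg,
    smul_add, smul_mul_assoc, mul_smul_comm, smul_smul]
  simp
  abel

theorem d₁_op_smul (a : Sphere q) (f : Ω₁ q) :
    d₁ (op a • f) = op a • d₁ f - wedge (bt _ f (d₀ a)) := by
  ext i
  simp only [d₁_apply, wedge_bt, Twisted.add_apply, Twisted.sub_apply, Twisted.smul_apply, d₀_mul,
    Twisted.op_smul_apply, add_mul, neg_mul, smul_add, smul_mul_assoc]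
  abel

theorem d₁_d₀ (a : Sphere q) : d₁ (d₀ a) = 0 := by
  have hm : ∀ a b : Sphere q, d₁ (d₀ (a * b)) = op b • d₁ (d₀ a) + a • d₁ (d₀ b) := by
    intro a b
    rw [d₀_mul, map_add, d₁_op_smul, d₁_smul]
    abel
  have hz : d₁ (d₀ (z q)) = 0 := by ext i; simp [d₁_apply]
  have hzbar : d₁ (d₀ (zbar q)) = 0 := by ext i; simp [d₁_apply]
  induction a using Sphere.induction with
  | halg c => simp
  | hz => exact hz
  | hzbar => exact hzbar
  | hw =>
    have h : d₁ (d₀ (w q * (zbar q * z q + 1))) = 0 := by rw [w_mul]; simp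
    have hS : d₁ (d₀ (zbar q * z q + 1)) = 0 := by rw [map_add, map_add, hm, hz, hzbar]; simp
    rw [hm, hS, smul_zero, add_zero] at h
    have h2 := congrArg (fun ω => op (w q) • ω) h
    simpa only [smul_zero, ← mul_smul, ← op_mul, mul_w, op_one, one_smul] using h2
  | hadd a b ha hb => simp [ha, hb]
  | hmul a b ha hb => simp [hm, ha, hb]

theorem d₁_z_dzbar : d₁ (z q • dz q 1) = Twisted.basis ((θ q).comp (θ q)) 0 := by
  ext i
  fin_cases i
  simp [d₁_apply, Twisted.basis_apply]

theorem one_form_eq (f : Ω₁ q) : f = op (f 0) • dz q 0 + op (f 1) • dz q 1 := by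
  ext i
  fin_cases i <;> simp

variable (q) in
/-- The differential calculus on `S²_q`. -/
def calculus : Calculus (Sphere q) (Ω₁ q) (Ω₂ q) where
  d₀ := d₀
  d₁ := d₁
  wedge := wedge
  wedge_smul := wedge_smul
  wedge_op_smul := wedge_op_smul
  d₀_mul := d₀_mul
  d₁_smul := d₁_smul
  d₁_op_smul := d₁_op_smul
  d₁_d₀ := d₁_d₀
  span_left₁ := by
    have h : ∀ a b : Sphere q,
        op b • d₀ a ∈ Submodule.span ℂ {ω | ∃ a b : Sphere q, ω = a • d₀ b} := by
      intro a b
      have h : op b • d₀ a = (1 : Sphere q) • d₀ (a * b) - a • d₀ b := by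
        rw [d₀_mul, one_smul]; abel
      rw [h]
      exact Submodule.sub_mem _ (Submodule.subset_span ⟨_, _, rfl⟩)
        (Submodule.subset_span ⟨_, _, rfl⟩)
    rw [eq_top_iff]
    intro f _
    rw [one_form_eq f, ← d₀_z, ← d₀_zbar]
    exact Submodule.add_mem _ (h _ _) (h _ _)
  span_right₁ := by
    rw [eq_top_iff]
    intro f _
    rw [one_form_eq f, ← d₀_z, ← d₀_zbar]
    exact Submodule.add_mem _ (Submodule.subset_span ⟨_, _, rfl⟩)
      (Submodule.subset_span ⟨_, _, rfl⟩)
  span_left₂ := by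
    rw [eq_top_iff]
    intro f _
    refine Submodule.subset_span ⟨rot q (q⁻¹ ^ 2)⁻¹ (rot q (q⁻¹ ^ 2)⁻¹ (f 0)), z q • dz q 1, ?_⟩
    rw [d₁_z_dzbar]
    ext i
    fin_cases i
    change f 0 = θ q (θ q (rot q (q⁻¹ ^ 2)⁻¹ (rot q (q⁻¹ ^ 2)⁻¹ (f 0)))) * _
    rw [rot_rot_inv, rot_rot_inv]
    simp [Twisted.basis_apply]
  span_right₂ := by
    rw [eq_top_iff]
    intro f _
    refine Submodule.subset_span ⟨f 0, z q • dz q 1, ?_⟩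
    rw [d₁_z_dzbar]
    ext i
    fin_cases i
    simp [Twisted.basis_apply]

end Sphere

end NCG

end

/-! The vector fields `∂_z`, `∂_z̄` are the coordinate functions of the free right module `Ω¹`. The
pairing with `∂_z̄ ⊗ ∂_z - q² ∂_z ⊗ ∂_z̄` is the coefficient of `∧` at `dz ∧ dz̄`
(`pairing_commutator`); hence this tensor annihilates `ker ∧`, and the two terms of its bracket
cancel.

The braiding `σ` of a bimodule connection is determined by `∇`: as `dz i.a` is a scalar multiple of
`a.dz i` for `a = z, z̄`, comparing the two Leibniz rules gives `σ(dz i ⊗ da)` (`sigma_dz`). For the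
given connections the algebra elements that occur all simplify to scalars, because `z`, `z̄` commute
with `(R + 1)⁻¹` up to powers of `q`, and `z z̄ + 1 = q⁻² (R + 1)`. So `σ` is given by a constant
`4 × 4` matrix in the basis `dz i ⊗ dz j`: it fixes `dz ⊗ dz` and `dz̄ ⊗ dz̄`, and `x` is the
determinant of the block on `dz ⊗ dz̄`, `dz̄ ⊗ dz`. Cramer's rule then inverts `σ`, and shows that
`x ≠ 0` if `σ` is injective. The last step needs `1 ≠ 0` in the algebra, which is seen from a
representation on sequences (`shiftRep`).

The induced braiding does not depend on the dual basis (`DualBasis.sum_bt_map_eq`), so it can be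
computed with `(dz, ∂_z)`, `(dz̄, ∂_z̄)`. It is a constant matrix again, and an explicit polynomial
tensor is mapped to the Kronecker delta times the denominator of the differential dimension
(`IsPrescribed.dualBraiding_eq_smul_delta`). If that denominator were zero, injectivity would make
the coefficients of the tensor vanish, and two of these are, up to nonzero factors, the coefficients
of the image of `∂_z ⊗ dz̄`, which would then be zero too. Dividing by the denominator and evaluating
gives the differential dimension. -/

namespace NCG

open MulOpposite

/-! ### Independence of the dual basis -/

section DualBasisIndependence

variable {A : Type*} [Ring A] [Algebra ℂ A]
  {E : Type*} [AddCommGroup E] [Module ℂ E] [Module A E] [Module Aᵐᵒᵖ E]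
  [SMulCommClass A Aᵐᵒᵖ E] [IsScalarTower ℂ A E] [IsScalarTower ℂ Aᵐᵒᵖ E]

theorem RDual.sum_apply {ι : Type*} (s : Finset ι) (α : ι → RDual A E) (x : E) :
    (∑ i ∈ s, α i) x = ∑ i ∈ s, α i x :=
  map_sum (⟨⟨fun α : RDual A E => α x, rfl⟩, fun _ _ => rfl⟩ : RDual A E →+ A) α s

theorem DualBasis.sum_smul_dual (B : DualBasis A E) (β : RDual A E) :
    ∑ i, β (B.e i) • B.α i = β := by
  ext x
  conv_rhs => rw [← B.sum_eq x]
  simp [RDual.sum_apply]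

/-- The tensor `∑ F(e_i) ⊗ α_i` attached to a right module map `F` does not depend on the dual
basis. -/
theorem DualBasis.sum_bt_map_eq (B B' : DualBasis A E) {G : Type*} [AddCommGroup G] [Module ℂ G]
    [Module Aᵐᵒᵖ G] (F : E →ₗ[Aᵐᵒᵖ] G) :
    ∑ i, bt A (F (B.e i)) (B.α i) = ∑ j, bt A (F (B'.e j)) (B'.α j) := by
  have h : ∀ i, bt A (F (B.e i)) (B.α i)
      = ∑ j, bt A (F (op (B.α i (B'.e j)) • B.e i)) (B'.α j) := by
    intro i
    conv_lhs => rw [← B'.sum_smul_dual (B.α i)]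
    rw [← btₗ_apply, map_sum]
    refine Finset.sum_congr rfl fun j _ => ?_
    rw [btₗ_apply, ← bt_balanced, map_smul]
  rw [Finset.sum_congr rfl fun i _ => h i, Finset.sum_comm]
  refine Finset.sum_congr rfl fun j _ => ?_
  conv_rhs => rw [← B.sum_eq (B'.e j), map_sum]
  rw [← btₗ_apply, map_sum, LinearMap.sum_apply]
  rfl

theorem DualBasis.delta_eq (B B' : DualBasis A E) : B.delta = B'.delta :=
  B.sum_bt_map_eq B' LinearMap.id

theorem contract_op_smul {F : Type*} [AddCommGroup F] [Module ℂ F] [Module A F] [Module Aᵐᵒᵖ F]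
    [SMulCommClass A Aᵐᵒᵖ F] [IsScalarTower ℂ A F] [IsScalarTower ℂ Aᵐᵒᵖ F]
    (α : RDual A E) (a : A) (t : BTensor A E F) :
    contract α (op a • t) = op a • contract α t := by
  change ((contract α).comp (BTensor.rightAct A E F (op a))) t
    = ((Algebra.lsmul ℂ ℂ F (op a)).comp (contract α)) t
  congr 1
  apply BTensor.ext
  intro e f
  simp [smul_comm (α e) (op a) f]

variable {Ω₁ : Type*} [AddCommGroup Ω₁] [Module ℂ Ω₁] [Module A Ω₁] [Module Aᵐᵒᵖ Ω₁]
  [SMulCommClass A Aᵐᵒᵖ Ω₁] [IsScalarTower ℂ A Ω₁] [IsScalarTower ℂ Aᵐᵒᵖ Ω₁]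
  {Ω₂ : Type*} [AddCommGroup Ω₂] [Module ℂ Ω₂] [Module A Ω₂] [Module Aᵐᵒᵖ Ω₂]
  [SMulCommClass A Aᵐᵒᵖ Ω₂] [IsScalarTower ℂ A Ω₂] [IsScalarTower ℂ Aᵐᵒᵖ Ω₂]
  {C : Calculus A Ω₁ Ω₂}

theorem BimoduleConnection.sigma_sigmaInv (D : BimoduleConnection C E)
    (hσ : Function.Bijective D.σ) (t : BTensor A Ω₁ E) : D.σ (D.sigmaInv hσ t) = t :=
  (LinearEquiv.ofBijective D.σ hσ).apply_symm_apply t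

theorem BimoduleConnection.sigmaInv_eq_of_sigma_eq (D : BimoduleConnection C E)
    (hσ : Function.Bijective D.σ) {s : BTensor A E Ω₁} {t : BTensor A Ω₁ E} (h : D.σ s = t) :
    D.sigmaInv hσ t = s :=
  hσ.1 (by rw [D.sigma_sigmaInv, h])

theorem BimoduleConnection.sigmaInv_op_smul (D : BimoduleConnection C E)
    (hσ : Function.Bijective D.σ) (a : A) (t : BTensor A Ω₁ E) :
    D.sigmaInv hσ (op a • t) = op a • D.sigmaInv hσ t :=
  D.sigmaInv_eq_of_sigma_eq hσ (by rw [D.σ_op_smul, D.sigma_sigmaInv])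

theorem BimoduleConnection.dualBraiding_eq (D : BimoduleConnection C E)
    (hσ : Function.Bijective D.σ) (B B' : DualBasis A E) :
    D.dualBraiding hσ B = D.dualBraiding hσ B' := by
  apply BTensor.ext
  intro α ξ
  simp only [BimoduleConnection.dualBraiding_bt]
  exact B.sum_bt_map_eq B'
    { toFun := fun e => contract α (D.sigmaInv hσ (bt A ξ e))
      map_add' := fun e e' => by rw [bt_add, map_add, map_add]
      map_smul' := fun a e => by
        obtain ⟨a, rfl⟩ := op_surjective a
        rw [← op_smul_bt, D.sigmaInv_op_smul, contract_op_smul, RingHom.id_apply] }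

end DualBasisIndependence

namespace Sphere

variable (q : ℂˣ)

/-! ### Nontriviality of the algebra -/

/-- The representation of `S²_q` on the space of sequences `ℤ → ℂ`: `R + 1` acts diagonally by
`q^(2n)`, `z` is a shift, and `z̄` a weighted shift in the opposite direction. -/
noncomputable def shiftRep : Sphere q →ₐ[ℂ] Module.End ℂ (ℤ → ℂ) :=
  lift
    { toFun := fun f n => f (n - 1), map_add' := fun _ _ => rfl, map_smul' := fun _ _ => rfl }
    { toFun := fun f n => ((q : ℂ) ^ (2 * n) - 1) * f (n + 1)
      map_add' := fun _ _ => by ext; simp [mul_add]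
      map_smul' := fun _ _ => by ext; simp [mul_left_comm] }
    { toFun := fun f n => (q : ℂ) ^ (-(2 * n)) * f n
      map_add' := fun _ _ => by ext; simp [mul_add]
      map_smul' := fun _ _ => by ext; simp [mul_left_comm] }
    (by
      refine LinearMap.ext fun f => funext fun n => ?_
      have h : (q : ℂ) ^ (2 * (n - 1)) = ((q : ℂ)⁻¹ ^ 2) * (q : ℂ) ^ (2 * n) := by
        rw [mul_sub, zpow_sub₀ q.ne_zero, div_eq_mul_inv, mul_comm, inv_pow]; rfl
      simp [Module.algebraMap_end_apply, h]
      ring)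
    (by
      refine LinearMap.ext fun f => funext fun n => ?_
      simp [zpow_neg]
      have := zpow_ne_zero (2 * n) q.ne_zero
      field_simp
      ring)
    (by
      refine LinearMap.ext fun f => funext fun n => ?_
      simp [zpow_neg]
      have := zpow_ne_zero (2 * n) q.ne_zero
      field_simp
      ring)

/-- Without this, `x ≠ 0` could not follow from the invertibility of `σ`. -/
instance : Nontrivial (Sphere q) := (shiftRep q).toRingHom.domain_nontrivial

variable {q}

theorem eq_zero_of_smul_one_eq_zero {c : ℂ} (h : c • (1 : Sphere q) = 0) : c = 0 := by
  rcases smul_eq_zero.1 h with h | h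
  · exact h
  · exact absurd h one_ne_zero

/-! ### Vector fields and the Lie bracket -/

variable (q) in
/-- The vector field dual to `dz i`, reading off the coefficient at `dz i`: it is `∂_z` for `i = 0`
and `∂_z̄` for `i = 1`. -/
noncomputable def partialD (i : Fin 2) : Vec (Sphere q) (Ω₁ q) :=
  ({ toFun := fun f => f i, map_add' := fun _ _ => rfl, map_smul' := fun _ _ => rfl } :
    Ω₁ q →ₗ[(Sphere q)ᵐᵒᵖ] Sphere q)

@[simp] theorem partialD_apply (i : Fin 2) (f : Ω₁ q) : partialD q i f = f i := rfl

variable (q) in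
/-- The dual basis `(dz, ∂_z)`, `(dz̄, ∂_z̄)`. -/
noncomputable def dualBasis : DualBasis (Sphere q) (Ω₁ q) where
  n := 2
  e := dz q
  α := partialD q
  sum_eq f := by rw [Fin.sum_univ_two]; exact (one_form_eq f).symm

theorem span_partialD : Submodule.span (Sphere q) {partialD q 0, partialD q 1} = ⊤ := by
  rw [eq_top_iff]
  intro X _
  rw [← (dualBasis q).sum_smul_dual X]
  refine Submodule.sum_mem _ fun (i : Fin 2) _ => Submodule.smul_mem _ _ (Submodule.subset_span ?_)
  change partialD q i ∈ _
  fin_cases i <;> simp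

/-- Under the pairing, `∂_z̄ ⊗ ∂_z - q² ∂_z ⊗ ∂_z̄` is the coefficient of the wedge product at
`dz ∧ dz̄`; hence it annihilates the kernel of `∧`, and its bracket cancels `d` against itself. -/
theorem pairing_commutator (t : BTensor (Sphere q) (Ω₁ q) (Ω₁ q)) :
    pairing _ _ (partialD q 1 ⊗ₜ[ℂ] partialD q 0 -
      ((q : ℂ) ^ 2) • (partialD q 0 ⊗ₜ[ℂ] partialD q 1)) t = wedge t 0 := by
  let coord : Ω₂ q →ₗ[ℂ] Sphere q :=
    { toFun := fun f => f 0, map_add' := fun _ _ => rfl, map_smul' := fun _ _ => rfl }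
  change _ = (coord.comp wedge) t
  congr 1
  apply BTensor.ext
  intro f g
  change _ = wedge (bt (Sphere q) f g) 0
  simp [wedge_bt]

theorem commutator_mem_antisymm :
    partialD q 1 ⊗ₜ[ℂ] partialD q 0 - ((q : ℂ) ^ 2) • (partialD q 0 ⊗ₜ[ℂ] partialD q 1)
      ∈ (calculus q).antisymm := by
  intro t ht
  rw [pairing_commutator]
  exact DFunLike.congr_fun (F := Ω₂ q) ht 0

theorem bracket_commutator :
    (calculus q).bracket ⟨_, commutator_mem_antisymm (q := q)⟩ = 0 := by
  ext f
  rw [Calculus.bracket_apply _ _ _ _ ((calculus q).wedge_liftD f), pairing_commutator]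
  have h : wedge ((calculus q).liftD f) = d₁ f := (calculus q).wedge_liftD f
  rw [h, d₁_apply]
  simp [calculus]

/-! ### Coefficients of tensors -/

/-- The coefficient `f ⊗ g ↦ θ(f_k) g_l` of `dz k ⊗ dz l` in the right module `Ω¹ ⊗ Ω¹`. -/
noncomputable def formCoeff (k l : Fin 2) : BTensor (Sphere q) (Ω₁ q) (Ω₁ q) →ₗ[ℂ] Sphere q :=
  pairing _ _ (partialD q l ⊗ₜ[ℂ] partialD q k)

@[simp] theorem formCoeff_dz (k l i j : Fin 2) :
    formCoeff k l (bt (Sphere q) (dz q i) (dz q j)) = if k = i ∧ l = j then 1 else 0 := by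
  fin_cases i <;> fin_cases j <;> fin_cases k <;> fin_cases l <;> simp [formCoeff]

/-- The coefficient `X ⊗ f ↦ X(dz k) f_l` of `∂_k ⊗ dz l` in `Vec ⊗ Ω¹`. -/
noncomputable def vecFormCoeff (k l : Fin 2) :
    BTensor (Sphere q) (Vec (Sphere q) (Ω₁ q)) (Ω₁ q) →ₗ[ℂ] Sphere q :=
  BTensor.lift _
    (LinearMap.mk₂ ℂ (fun X f => X (dz q k) * f l)
      (fun _ _ _ => by simp [add_mul]) (fun _ _ _ => by simp)
      (fun _ _ _ => by simp [mul_add]) (fun _ _ _ => by simp))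
    (fun X a f => by
      have h : a • dz q k = op (θ q a) • dz q k := by
        ext j; fin_cases k <;> fin_cases j <;> simp
      simp only [LinearMap.mk₂_apply, RDual.op_smul_apply, Twisted.smul_apply]
      rw [h, RDual.map_op_smul, mul_assoc])

@[simp] theorem vecFormCoeff_bt (k l i j : Fin 2) :
    vecFormCoeff k l (bt (Sphere q) (partialD q i) (dz q j)) = if k = i ∧ l = j then 1 else 0 := by
  change partialD q i (dz q k) * dz q j l = _
  fin_cases i <;> fin_cases j <;> fin_cases k <;> fin_cases l <;> simp

/-- The tensors `dz i ⊗ dz j` are linearly independent over `ℂ`. -/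
theorem eq_zero_of_sum_dz_eq_zero {c₀₀ c₀₁ c₁₀ c₁₁ : ℂ}
    (h : c₀₀ • bt (Sphere q) (dz q 0) (dz q 0) + c₀₁ • bt (Sphere q) (dz q 0) (dz q 1) +
      c₁₀ • bt (Sphere q) (dz q 1) (dz q 0) + c₁₁ • bt (Sphere q) (dz q 1) (dz q 1) = 0) :
    c₀₀ = 0 ∧ c₀₁ = 0 ∧ c₁₀ = 0 ∧ c₁₁ = 0 := by
  refine ⟨eq_zero_of_smul_one_eq_zero (q := q) ?_, eq_zero_of_smul_one_eq_zero (q := q) ?_,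
    eq_zero_of_smul_one_eq_zero (q := q) ?_, eq_zero_of_smul_one_eq_zero (q := q) ?_⟩
  · simpa using congrArg (formCoeff 0 0) h
  · simpa using congrArg (formCoeff 0 1) h
  · simpa using congrArg (formCoeff 1 0) h
  · simpa using congrArg (formCoeff 1 1) h

/-- The tensors `∂_i ⊗ dz j` are linearly independent over `ℂ`. -/
theorem eq_zero_of_sum_partialD_dz_eq_zero {c₀₀ c₀₁ c₁₀ c₁₁ : ℂ}
    (h : c₀₀ • bt (Sphere q) (partialD q 0) (dz q 0) +
      c₀₁ • bt (Sphere q) (partialD q 0) (dz q 1) +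
      c₁₀ • bt (Sphere q) (partialD q 1) (dz q 0) +
      c₁₁ • bt (Sphere q) (partialD q 1) (dz q 1) = 0) :
    c₀₀ = 0 ∧ c₀₁ = 0 ∧ c₁₀ = 0 ∧ c₁₁ = 0 := by
  refine ⟨eq_zero_of_smul_one_eq_zero (q := q) ?_, eq_zero_of_smul_one_eq_zero (q := q) ?_,
    eq_zero_of_smul_one_eq_zero (q := q) ?_, eq_zero_of_smul_one_eq_zero (q := q) ?_⟩
  · simpa using congrArg (vecFormCoeff 0 0) h
  · simpa using congrArg (vecFormCoeff 0 1) h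
  · simpa using congrArg (vecFormCoeff 1 0) h
  · simpa using congrArg (vecFormCoeff 1 1) h

/-! ### The braiding of one-forms -/

theorem csmul_smul_BTensor (c : ℂ) (a : Sphere q) (t : BTensor (Sphere q) (Ω₁ q) (Ω₁ q)) :
    (c • a) • t = c • a • t := by
  change BTensor.leftAct _ _ _ (c • a) t = (c • BTensor.leftAct (Sphere q) (Ω₁ q) (Ω₁ q) a) t
  congr 1
  apply BTensor.ext
  intro f g
  simp [csmul_bt]

theorem op_z_smul_dz (i : Fin 2) : op (z q) • dz q i = ((q : ℂ) ^ 2) • (z q • dz q i) := by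
  rw [z_smul_dz, smul_smul, inv_pow, mul_inv_cancel₀ (pow_ne_zero 2 q.ne_zero), one_smul]

theorem op_zbar_smul_dz (i : Fin 2) :
    op (zbar q) • dz q i = ((q : ℂ)⁻¹ ^ 2) • (zbar q • dz q i) := by
  rw [zbar_smul_dz, smul_smul, inv_pow, inv_mul_cancel₀ (pow_ne_zero 2 q.ne_zero), one_smul]

/-- Moving an element past a tensor of basis forms, on which it acts by the square of the scalar
by which it commutes with each of them. -/
theorem op_smul_smul_dz_dz {a : Sphere q} {c : ℂ} (ha : ∀ i, op a • dz q i = c • (a • dz q i))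
    (m : Sphere q) (i j : Fin 2) :
    op a • m • bt (Sphere q) (dz q i) (dz q j)
      = (c ^ 2 • (m * a)) • bt (Sphere q) (dz q i) (dz q j) := by
  rw [csmul_smul_BTensor, smul_bt, op_smul_bt, ha, bt_csmul, ← bt_balanced,
    ← smul_comm m (op a), ha, smul_comm m c, csmul_bt, smul_smul, ← sq, smul_smul, smul_bt]

/-- The braiding on `dz i ⊗ da`, for `a` commuting with the basis forms up to a scalar, in terms of
the coefficients of `∇(dz i)`. -/
theorem sigma_dz (D : BimoduleConnection (calculus q) (Ω₁ q)) {a : Sphere q} {c : ℂ}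
    (ha : ∀ i, op a • dz q i = c • (a • dz q i)) (i : Fin 2) (M : Sphere q)
    (N : Fin 2 → Fin 2 → Sphere q)
    (hD : D.nabla (dz q i) = M • bt (Sphere q) (dz q i) (dz q i) +
      ∑ k, ∑ l, N k l • bt (Sphere q) (dz q k) (dz q l)) :
    D.σ (bt (Sphere q) (dz q i) (d₀ a)) = c • bt (Sphere q) (d₀ a) (dz q i) +
      (c • (a * M) - c ^ 2 • (M * a)) • bt (Sphere q) (dz q i) (dz q i) +
      ∑ k, ∑ l, (c • (a * N k l) - c ^ 2 • (N k l * a)) • bt (Sphere q) (dz q k) (dz q l) := by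
  have h := D.nabla_op_smul a (dz q i)
  rw [ha, map_smul, D.nabla_smul, hD] at h
  have h' := sub_eq_of_eq_add' h
  change _ = D.σ (bt (Sphere q) (dz q i) (d₀ a)) at h'
  change c • (bt (Sphere q) (d₀ a) (dz q i) + _) - _ = _ at h'
  rw [← h']
  simp only [Fin.sum_univ_two, smul_add, op_smul_smul_dz_dz ha, sub_smul, csmul_smul_BTensor,
    mul_smul]
  abel

theorem z_mul_zbar_add_one : z q * zbar q + 1 = ((q : ℂ)⁻¹ ^ 2) • (zbar q * z q + 1) := by
  rw [z_mul_zbar, Algebra.algebraMap_eq_smul_one, sub_smul, one_smul, smul_add]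
  abel

theorem mul_w_of_commutes {a : Sphere q} {c : ℂ}
    (h : (zbar q * z q + 1) * a = c • (a * (zbar q * z q + 1))) : a * w q = c • (w q * a) := by
  have h' := congrArg (fun t => w q * t * w q) h
  simpa only [mul_smul_comm, smul_mul_assoc, ← mul_assoc (w q), w_mul, one_mul,
    mul_assoc _ _ (w q), mul_w, mul_one] using h'

theorem z_mul_w : z q * w q = ((q : ℂ) ^ 2) • (w q * z q) := by
  apply mul_w_of_commutes
  have h : z q * (zbar q * z q + 1) = (z q * zbar q + 1) * z q := by
    rw [mul_add, add_mul, mul_one, one_mul, mul_assoc]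
  rw [h, z_mul_zbar_add_one, smul_mul_assoc, smul_smul, inv_pow,
    mul_inv_cancel₀ (pow_ne_zero 2 q.ne_zero), one_smul]

theorem zbar_mul_w : zbar q * w q = ((q : ℂ)⁻¹ ^ 2) • (w q * zbar q) := by
  apply mul_w_of_commutes
  rw [← mul_smul_comm, ← z_mul_zbar_add_one, mul_add, add_mul, mul_one, one_mul, mul_assoc]

theorem w_mul_zbar_mul_z : w q * (zbar q * z q) = 1 - w q := by
  rw [eq_sub_iff_add_eq, ← w_mul q, mul_add, mul_one]

theorem w_mul_z_mul_zbar :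
    w q * (z q * zbar q) = ((q : ℂ)⁻¹ ^ 2) • 1 - w q := by
  rw [eq_sub_iff_add_eq]
  nth_rw 2 [← mul_one (w q)]
  rw [← mul_add, z_mul_zbar_add_one, mul_smul_comm, w_mul]

/-- The family of connections under consideration: `∇(dz)` and `∇(dz̄)` are `(R + 1)⁻¹` times
combinations of the tensors `dz i ⊗ dz j` with coefficients of degree at most one. -/
structure IsPrescribed (D : BimoduleConnection (calculus q) (Ω₁ q))
    (g₀ h₀ h₁ : Fin 2 → Fin 2 → ℂ) : Prop where
  nabla_dz : D.nabla (dz q 0) =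
    (((q : ℂ)⁻¹ ^ 2) • (w q * zbar q)) • bt (Sphere q) (dz q 0) (dz q 0) +
      ∑ i, ∑ j, (w q * (algebraMap ℂ (Sphere q) (g₀ i j) + ((q : ℂ) ^ 6 * h₁ i j) • z q)) •
        bt (Sphere q) (dz q i) (dz q j)
  nabla_dzbar : D.nabla (dz q 1) =
    (((q : ℂ) ^ 4) • (w q * z q)) • bt (Sphere q) (dz q 1) (dz q 1) +
      ∑ i, ∑ j, (w q * (algebraMap ℂ (Sphere q) (h₀ i j) + h₁ i j • zbar q)) •
        bt (Sphere q) (dz q i) (dz q j)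

section Braiding

variable {D : BimoduleConnection (calculus q) (Ω₁ q)} {g₀ h₀ h₁ : Fin 2 → Fin 2 → ℂ}

theorem IsPrescribed.sigma_dz_dz (hD : IsPrescribed D g₀ h₀ h₁) :
    D.σ (bt (Sphere q) (dz q 0) (dz q 0)) = bt (Sphere q) (dz q 0) (dz q 0) := by
  have hq := q.ne_zero
  have h := sigma_dz D op_z_smul_dz 0 _ _ hD.nabla_dz
  have hN : ∀ k l, ((q : ℂ) ^ 2) • (z q * (w q * (algebraMap ℂ (Sphere q) (g₀ k l) +
      ((q : ℂ) ^ 6 * h₁ k l) • z q))) -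
      ((q : ℂ) ^ 2) ^ 2 • (w q * (algebraMap ℂ (Sphere q) (g₀ k l) +
      ((q : ℂ) ^ 6 * h₁ k l) • z q) * z q) = 0 := by
    intro k l
    simp only [← mul_assoc (z q), z_mul_w, Algebra.algebraMap_eq_smul_one, mul_add, add_mul,
      mul_smul_comm, smul_mul_assoc, mul_one, mul_assoc]
    module
  have hM : ((q : ℂ) ^ 2) • (z q * (((q : ℂ)⁻¹ ^ 2) • (w q * zbar q))) -
      ((q : ℂ) ^ 2) ^ 2 • (((q : ℂ)⁻¹ ^ 2) • (w q * zbar q) * z q) = (1 - (q : ℂ) ^ 2) • 1 := by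
    simp only [mul_smul_comm, smul_mul_assoc, ← mul_assoc (z q), z_mul_w]
    simp only [mul_assoc, w_mul_zbar_mul_z, w_mul_z_mul_zbar]
    match_scalars <;> field_simp
    ring
  simp only [hN, hM, zero_smul, Finset.sum_const_zero, add_zero, csmul_smul_BTensor, one_smul, d₀_z]
    at h
  rw [h]
  module

theorem IsPrescribed.sigma_dzbar_dzbar (hD : IsPrescribed D g₀ h₀ h₁) :
    D.σ (bt (Sphere q) (dz q 1) (dz q 1)) = bt (Sphere q) (dz q 1) (dz q 1) := by
  have hq := q.ne_zero
  have h := sigma_dz D op_zbar_smul_dz 1 _ _ hD.nabla_dzbar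
  have hN : ∀ k l, ((q : ℂ)⁻¹ ^ 2) • (zbar q * (w q * (algebraMap ℂ (Sphere q) (h₀ k l) +
      h₁ k l • zbar q))) - ((q : ℂ)⁻¹ ^ 2) ^ 2 • (w q * (algebraMap ℂ (Sphere q) (h₀ k l) +
      h₁ k l • zbar q) * zbar q) = 0 := by
    intro k l
    simp only [← mul_assoc (zbar q), zbar_mul_w, Algebra.algebraMap_eq_smul_one, mul_add, add_mul,
      mul_smul_comm, smul_mul_assoc, mul_one, mul_assoc]
    module
  have hM : ((q : ℂ)⁻¹ ^ 2) • (zbar q * (((q : ℂ) ^ 4) • (w q * z q))) -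
      ((q : ℂ)⁻¹ ^ 2) ^ 2 • (((q : ℂ) ^ 4) • (w q * z q) * zbar q) = (1 - (q : ℂ)⁻¹ ^ 2) • 1 := by
    simp only [mul_smul_comm, smul_mul_assoc, ← mul_assoc (zbar q), zbar_mul_w]
    simp only [mul_assoc, w_mul_zbar_mul_z, w_mul_z_mul_zbar]
    match_scalars <;> field_simp
    ring
  simp only [hN, hM, zero_smul, Finset.sum_const_zero, add_zero, csmul_smul_BTensor, one_smul,
    d₀_zbar] at h
  rw [h]
  module

theorem IsPrescribed.sigma_dz_dzbar (hD : IsPrescribed D g₀ h₀ h₁) :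
    D.σ (bt (Sphere q) (dz q 0) (dz q 1)) = ((q : ℂ)⁻¹ ^ 2) • bt (Sphere q) (dz q 1) (dz q 0) +
      ∑ k, ∑ l, (((q : ℂ) ^ 2 - 1) * h₁ k l) • bt (Sphere q) (dz q k) (dz q l) := by
  have hq := q.ne_zero
  have h := sigma_dz D op_zbar_smul_dz 0 _ _ hD.nabla_dz
  have hN : ∀ k l, ((q : ℂ)⁻¹ ^ 2) • (zbar q * (w q * (algebraMap ℂ (Sphere q) (g₀ k l) +
      ((q : ℂ) ^ 6 * h₁ k l) • z q))) -
      ((q : ℂ)⁻¹ ^ 2) ^ 2 • (w q * (algebraMap ℂ (Sphere q) (g₀ k l) +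
      ((q : ℂ) ^ 6 * h₁ k l) • z q) * zbar q) = (((q : ℂ) ^ 2 - 1) * h₁ k l) • 1 := by
    intro k l
    simp only [← mul_assoc (zbar q), zbar_mul_w, Algebra.algebraMap_eq_smul_one, mul_add, add_mul,
      mul_smul_comm, smul_mul_assoc, mul_one]
    simp only [mul_assoc, w_mul_zbar_mul_z, w_mul_z_mul_zbar]
    match_scalars <;> field_simp <;> ring
  have hM : ((q : ℂ)⁻¹ ^ 2) • (zbar q * (((q : ℂ)⁻¹ ^ 2) • (w q * zbar q))) -
      ((q : ℂ)⁻¹ ^ 2) ^ 2 • (((q : ℂ)⁻¹ ^ 2) • (w q * zbar q) * zbar q) = 0 := by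
    simp only [mul_smul_comm, smul_mul_assoc, ← mul_assoc (zbar q), zbar_mul_w]
    module
  simp only [hN, hM, zero_smul, add_zero, csmul_smul_BTensor, one_smul, d₀_zbar] at h
  exact h

theorem IsPrescribed.sigma_dzbar_dz (hD : IsPrescribed D g₀ h₀ h₁) :
    D.σ (bt (Sphere q) (dz q 1) (dz q 0)) = ((q : ℂ) ^ 2) • bt (Sphere q) (dz q 0) (dz q 1) -
      ∑ k, ∑ l, ((q : ℂ) ^ 2 * ((q : ℂ) ^ 2 - 1) * h₁ k l) •
        bt (Sphere q) (dz q k) (dz q l) := by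
  have hq := q.ne_zero
  have h := sigma_dz D op_z_smul_dz 1 _ _ hD.nabla_dzbar
  have hN : ∀ k l, ((q : ℂ) ^ 2) • (z q * (w q * (algebraMap ℂ (Sphere q) (h₀ k l) +
      h₁ k l • zbar q))) - ((q : ℂ) ^ 2) ^ 2 • (w q * (algebraMap ℂ (Sphere q) (h₀ k l) +
      h₁ k l • zbar q) * z q) = (-((q : ℂ) ^ 2 * ((q : ℂ) ^ 2 - 1) * h₁ k l)) • 1 := by
    intro k l
    simp only [← mul_assoc (z q), z_mul_w, Algebra.algebraMap_eq_smul_one, mul_add, add_mul,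
      mul_smul_comm, smul_mul_assoc, mul_one]
    simp only [mul_assoc, w_mul_zbar_mul_z, w_mul_z_mul_zbar]
    match_scalars <;> field_simp <;> ring
  have hM : ((q : ℂ) ^ 2) • (z q * (((q : ℂ) ^ 4) • (w q * z q))) -
      ((q : ℂ) ^ 2) ^ 2 • (((q : ℂ) ^ 4) • (w q * z q) * z q) = 0 := by
    simp only [mul_smul_comm, smul_mul_assoc, ← mul_assoc (z q), z_mul_w]
    module
  simp only [hN, hM, zero_smul, add_zero, csmul_smul_BTensor, one_smul, d₀_z, neg_smul,
    Finset.sum_neg_distrib, ← sub_eq_add_neg] at h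
  exact h

end Braiding

/-! ### The induced braiding and the differential dimension -/

section DualBraiding

variable {D : BimoduleConnection (calculus q) (Ω₁ q)} {g₀ h₀ h₁ : Fin 2 → Fin 2 → ℂ} {x : ℂ}

/-- Cramer's rule for the block of `σ` on `dz ⊗ dz̄` and `dz̄ ⊗ dz`, whose determinant is `x`: the
preimage of `x dz ⊗ dz̄`. -/
theorem IsPrescribed.sigma_eq_smul_dz_dzbar (hD : IsPrescribed D g₀ h₀ h₁)
    (hx : x = ((q : ℂ) ^ 2 - 1) * (h₁ 0 1 - (q : ℂ) ^ 2 * h₁ 1 0) - 1) :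
    D.σ ((-(((q : ℂ) ^ 2 - 1) * h₁ 0 0)) • bt (Sphere q) (dz q 0) (dz q 0) +
        (-((q : ℂ) ^ 2 * ((q : ℂ) ^ 2 - 1) * h₁ 1 0)) • bt (Sphere q) (dz q 0) (dz q 1) +
        (-((q : ℂ)⁻¹ ^ 2 + ((q : ℂ) ^ 2 - 1) * h₁ 1 0)) • bt (Sphere q) (dz q 1) (dz q 0) +
        (-(((q : ℂ) ^ 2 - 1) * h₁ 1 1)) • bt (Sphere q) (dz q 1) (dz q 1))
      = x • bt (Sphere q) (dz q 0) (dz q 1) := by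
  have hq := q.ne_zero
  simp only [map_add, map_smul, hD.sigma_dz_dz, hD.sigma_dz_dzbar, hD.sigma_dzbar_dz,
    hD.sigma_dzbar_dzbar, Fin.sum_univ_two, hx]
  match_scalars <;> field_simp <;> ring

/-- Cramer's rule as in `IsPrescribed.sigma_eq_smul_dz_dzbar`: the preimage of `x dz̄ ⊗ dz`. -/
theorem IsPrescribed.sigma_eq_smul_dzbar_dz (hD : IsPrescribed D g₀ h₀ h₁)
    (hx : x = ((q : ℂ) ^ 2 - 1) * (h₁ 0 1 - (q : ℂ) ^ 2 * h₁ 1 0) - 1) :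
    D.σ (((q : ℂ) ^ 2 * ((q : ℂ) ^ 2 - 1) * h₁ 0 0) • bt (Sphere q) (dz q 0) (dz q 0) +
        (-((q : ℂ) ^ 2 * (1 - ((q : ℂ) ^ 2 - 1) * h₁ 0 1))) • bt (Sphere q) (dz q 0) (dz q 1) +
        (((q : ℂ) ^ 2 - 1) * h₁ 0 1) • bt (Sphere q) (dz q 1) (dz q 0) +
        ((q : ℂ) ^ 2 * ((q : ℂ) ^ 2 - 1) * h₁ 1 1) • bt (Sphere q) (dz q 1) (dz q 1))
      = x • bt (Sphere q) (dz q 1) (dz q 0) := by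
  have hq := q.ne_zero
  simp only [map_add, map_smul, hD.sigma_dz_dz, hD.sigma_dz_dzbar, hD.sigma_dzbar_dz,
    hD.sigma_dzbar_dzbar, Fin.sum_univ_two, hx]
  match_scalars <;> field_simp <;> ring

/-- If `x = 0`, the preimage of `x dz ⊗ dz̄` vanishes by injectivity, so that both `s (h₁ 1 0)` and
`q⁻² + s (h₁ 1 0)` are zero, where `s = q² - 1`. -/
theorem IsPrescribed.ne_zero_of_injective (hD : IsPrescribed D g₀ h₀ h₁)
    (hσ : Function.Injective D.σ)
    (hx : x = ((q : ℂ) ^ 2 - 1) * (h₁ 0 1 - (q : ℂ) ^ 2 * h₁ 1 0) - 1) : x ≠ 0 := by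
  intro h0
  have h := hD.sigma_eq_smul_dz_dzbar hx
  rw [h0, zero_smul, map_eq_zero_iff _ hσ] at h
  obtain ⟨-, h1, h2, -⟩ := eq_zero_of_sum_dz_eq_zero h
  have hq := q.ne_zero
  have h3 : ((q : ℂ) ^ 2 - 1) * h₁ 1 0 = 0 := by
    have h4 := neg_eq_zero.1 h1
    rw [mul_assoc] at h4
    exact (mul_eq_zero.1 h4).resolve_left (pow_ne_zero 2 hq)
  rw [h3, add_zero] at h2
  exact pow_ne_zero 2 (inv_ne_zero hq) (neg_eq_zero.1 h2)

theorem dualBraiding_apply (hσ : Function.Bijective D.σ) (B : DualBasis (Sphere q) (Ω₁ q))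
    (X : Vec (Sphere q) (Ω₁ q)) (f : Ω₁ q) :
    D.dualBraiding hσ B (bt (Sphere q) X f) =
      bt (Sphere q) (contract X (D.sigmaInv hσ (bt (Sphere q) f (dz q 0)))) (partialD q 0) +
      bt (Sphere q) (contract X (D.sigmaInv hσ (bt (Sphere q) f (dz q 1)))) (partialD q 1) := by
  rw [D.dualBraiding_eq hσ B (dualBasis q), BimoduleConnection.dualBraiding_bt]
  exact Fin.sum_univ_two _

theorem delta_eq (B : DualBasis (Sphere q) (Ω₁ q)) :
    B.delta = bt (Sphere q) (dz q 0) (partialD q 0) + bt (Sphere q) (dz q 1) (partialD q 1) := by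
  rw [B.delta_eq (dualBasis q)]
  exact Fin.sum_univ_two _

theorem IsPrescribed.sigmaInv_dz_dzbar (hD : IsPrescribed D g₀ h₀ h₁)
    (hσ : Function.Bijective D.σ)
    (hx : x = ((q : ℂ) ^ 2 - 1) * (h₁ 0 1 - (q : ℂ) ^ 2 * h₁ 1 0) - 1) :
    D.sigmaInv hσ (bt (Sphere q) (dz q 0) (dz q 1)) =
      x⁻¹ • ((-(((q : ℂ) ^ 2 - 1) * h₁ 0 0)) • bt (Sphere q) (dz q 0) (dz q 0) +
        (-((q : ℂ) ^ 2 * ((q : ℂ) ^ 2 - 1) * h₁ 1 0)) • bt (Sphere q) (dz q 0) (dz q 1) +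
        (-((q : ℂ)⁻¹ ^ 2 + ((q : ℂ) ^ 2 - 1) * h₁ 1 0)) • bt (Sphere q) (dz q 1) (dz q 0) +
        (-(((q : ℂ) ^ 2 - 1) * h₁ 1 1)) • bt (Sphere q) (dz q 1) (dz q 1)) :=
  D.sigmaInv_eq_of_sigma_eq hσ (by
    rw [map_smul, hD.sigma_eq_smul_dz_dzbar hx, inv_smul_smul₀ (hD.ne_zero_of_injective hσ.1 hx)])

theorem IsPrescribed.sigmaInv_dzbar_dz (hD : IsPrescribed D g₀ h₀ h₁)
    (hσ : Function.Bijective D.σ)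
    (hx : x = ((q : ℂ) ^ 2 - 1) * (h₁ 0 1 - (q : ℂ) ^ 2 * h₁ 1 0) - 1) :
    D.sigmaInv hσ (bt (Sphere q) (dz q 1) (dz q 0)) =
      x⁻¹ • (((q : ℂ) ^ 2 * ((q : ℂ) ^ 2 - 1) * h₁ 0 0) • bt (Sphere q) (dz q 0) (dz q 0) +
        (-((q : ℂ) ^ 2 * (1 - ((q : ℂ) ^ 2 - 1) * h₁ 0 1))) • bt (Sphere q) (dz q 0) (dz q 1) +
        (((q : ℂ) ^ 2 - 1) * h₁ 0 1) • bt (Sphere q) (dz q 1) (dz q 0) +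
        ((q : ℂ) ^ 2 * ((q : ℂ) ^ 2 - 1) * h₁ 1 1) • bt (Sphere q) (dz q 1) (dz q 1)) :=
  D.sigmaInv_eq_of_sigma_eq hσ (by
    rw [map_smul, hD.sigma_eq_smul_dzbar_dz hx, inv_smul_smul₀ (hD.ne_zero_of_injective hσ.1 hx)])

theorem IsPrescribed.dualBraiding_partialz_dz (hD : IsPrescribed D g₀ h₀ h₁)
    (hσ : Function.Bijective D.σ)
    (hx : x = ((q : ℂ) ^ 2 - 1) * (h₁ 0 1 - (q : ℂ) ^ 2 * h₁ 1 0) - 1)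
    (B : DualBasis (Sphere q) (Ω₁ q)) :
    D.dualBraiding hσ B (bt (Sphere q) (partialD q 0) (dz q 0)) =
      bt (Sphere q) (dz q 0) (partialD q 0)
        + (h₁ 0 0 * (1 - (q : ℂ) ^ 2) / x) • bt (Sphere q) (dz q 0) (partialD q 1)
        + (h₁ 1 0 * ((q : ℂ) ^ 2 - (q : ℂ) ^ 4) / x) • bt (Sphere q) (dz q 1) (partialD q 1) := by
  have hx0 := hD.ne_zero_of_injective hσ.1 hx
  have hq := q.ne_zero
  rw [dualBraiding_apply, D.sigmaInv_eq_of_sigma_eq hσ hD.sigma_dz_dz,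
    hD.sigmaInv_dz_dzbar hσ hx]
  simp only [map_add, map_smul, contract_bt, partialD_apply, dz_zero_zero, dz_one_zero,
    one_smul, zero_smul, smul_zero, add_zero, add_bt, csmul_bt]
  match_scalars <;> field_simp <;> ring

theorem IsPrescribed.dualBraiding_partialz_dzbar (hD : IsPrescribed D g₀ h₀ h₁)
    (hσ : Function.Bijective D.σ)
    (hx : x = ((q : ℂ) ^ 2 - 1) * (h₁ 0 1 - (q : ℂ) ^ 2 * h₁ 1 0) - 1)
    (B : DualBasis (Sphere q) (Ω₁ q)) :
    D.dualBraiding hσ B (bt (Sphere q) (partialD q 0) (dz q 1)) =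
      (h₁ 0 0 * ((q : ℂ) ^ 4 - (q : ℂ) ^ 2) / x) • bt (Sphere q) (dz q 0) (partialD q 0)
        + ((h₁ 0 1 * ((q : ℂ) ^ 4 - (q : ℂ) ^ 2) - (q : ℂ) ^ 2) / x) •
          bt (Sphere q) (dz q 1) (partialD q 0) := by
  have hx0 := hD.ne_zero_of_injective hσ.1 hx
  have hq := q.ne_zero
  rw [dualBraiding_apply, hD.sigmaInv_dzbar_dz hσ hx,
    D.sigmaInv_eq_of_sigma_eq hσ hD.sigma_dzbar_dzbar]
  simp only [map_add, map_smul, contract_bt, partialD_apply, dz_zero_zero, dz_one_zero,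
    one_smul, zero_smul, smul_zero, add_zero, add_bt, csmul_bt, zero_bt]
  match_scalars <;> field_simp
  ring

theorem IsPrescribed.dualBraiding_partialzbar_dz (hD : IsPrescribed D g₀ h₀ h₁)
    (hσ : Function.Bijective D.σ)
    (hx : x = ((q : ℂ) ^ 2 - 1) * (h₁ 0 1 - (q : ℂ) ^ 2 * h₁ 1 0) - 1)
    (B : DualBasis (Sphere q) (Ω₁ q)) :
    D.dualBraiding hσ B (bt (Sphere q) (partialD q 1) (dz q 0)) =
      ((h₁ 1 0 * (1 - (q : ℂ) ^ 2) - 1 / (q : ℂ) ^ 2) / x) •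
          bt (Sphere q) (dz q 0) (partialD q 1)
        + (h₁ 1 1 * (1 - (q : ℂ) ^ 2) / x) • bt (Sphere q) (dz q 1) (partialD q 1) := by
  have hx0 := hD.ne_zero_of_injective hσ.1 hx
  have hq := q.ne_zero
  rw [dualBraiding_apply, D.sigmaInv_eq_of_sigma_eq hσ hD.sigma_dz_dz,
    hD.sigmaInv_dz_dzbar hσ hx]
  simp only [map_add, map_smul, contract_bt, partialD_apply, dz_zero_one, dz_one_one,
    one_smul, zero_smul, smul_zero, add_zero, zero_add, add_bt, csmul_bt, zero_bt]
  match_scalars <;> field_simp <;> ring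

theorem IsPrescribed.dualBraiding_partialzbar_dzbar (hD : IsPrescribed D g₀ h₀ h₁)
    (hσ : Function.Bijective D.σ)
    (hx : x = ((q : ℂ) ^ 2 - 1) * (h₁ 0 1 - (q : ℂ) ^ 2 * h₁ 1 0) - 1)
    (B : DualBasis (Sphere q) (Ω₁ q)) :
    D.dualBraiding hσ B (bt (Sphere q) (partialD q 1) (dz q 1)) =
      (h₁ 0 1 * ((q : ℂ) ^ 2 - 1) / x) • bt (Sphere q) (dz q 0) (partialD q 0)
        + (h₁ 1 1 * ((q : ℂ) ^ 4 - (q : ℂ) ^ 2) / x) • bt (Sphere q) (dz q 1) (partialD q 0)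
        + bt (Sphere q) (dz q 1) (partialD q 1) := by
  have hx0 := hD.ne_zero_of_injective hσ.1 hx
  have hq := q.ne_zero
  rw [dualBraiding_apply, hD.sigmaInv_dzbar_dz hσ hx,
    D.sigmaInv_eq_of_sigma_eq hσ hD.sigma_dzbar_dzbar]
  simp only [map_add, map_smul, contract_bt, partialD_apply, dz_zero_one, dz_one_one,
    one_smul, zero_smul, smul_zero, add_zero, zero_add, add_bt, csmul_bt]
  match_scalars <;> field_simp

/-- The Kronecker delta, multiplied by the denominator of the differential dimension, has a preimage
under the induced braiding whose coefficients are polynomials in `h₁`. Clearing denominators keeps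
the formula valid where that denominator vanishes. -/
theorem IsPrescribed.dualBraiding_eq_smul_delta (hD : IsPrescribed D g₀ h₀ h₁)
    (hσ : Function.Bijective D.σ)
    (hx : x = ((q : ℂ) ^ 2 - 1) * (h₁ 0 1 - (q : ℂ) ^ 2 * h₁ 1 0) - 1)
    (B : DualBasis (Sphere q) (Ω₁ q)) :
    D.dualBraiding hσ B
      ((-(x * ((q : ℂ) ^ 2 * ((q : ℂ)⁻¹ ^ 2 + ((q : ℂ) ^ 2 - 1) * h₁ 1 0)))) •
          bt (Sphere q) (partialD q 0) (dz q 0) +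
        (-(x * (((q : ℂ) ^ 2 - 1) * h₁ 1 1))) • bt (Sphere q) (partialD q 0) (dz q 1) +
        (x * ((q : ℂ) ^ 2 * (((q : ℂ) ^ 2 - 1) * h₁ 0 0))) • bt (Sphere q) (partialD q 1) (dz q 0) +
        (-(x * (1 - ((q : ℂ) ^ 2 - 1) * h₁ 0 1))) • bt (Sphere q) (partialD q 1) (dz q 1))
      = (x ^ 2 + (q : ℂ) ^ 2 * ((q : ℂ) ^ 2 - 1) ^ 2 * (h₁ 0 1 * h₁ 1 0 - h₁ 0 0 * h₁ 1 1)) •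
        B.delta := by
  have hx0 := hD.ne_zero_of_injective hσ.1 hx
  have hq := q.ne_zero
  rw [delta_eq]
  simp only [map_add, map_smul, hD.dualBraiding_partialz_dz hσ hx,
    hD.dualBraiding_partialz_dzbar hσ hx, hD.dualBraiding_partialzbar_dz hσ hx,
    hD.dualBraiding_partialzbar_dzbar hσ hx]
  match_scalars <;> field_simp <;> (try rw [hx]) <;> ring

/-- If the denominator vanishes, the explicit preimage of its multiple of the Kronecker delta is
zero, and its coefficients then put `∂_z ⊗ dz̄` in the kernel of the induced braiding. -/
theorem IsPrescribed.denominator_ne_zero (hD : IsPrescribed D g₀ h₀ h₁)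
    (hσ : Function.Bijective D.σ)
    (hx : x = ((q : ℂ) ^ 2 - 1) * (h₁ 0 1 - (q : ℂ) ^ 2 * h₁ 1 0) - 1)
    (B : DualBasis (Sphere q) (Ω₁ q)) (hV : Function.Injective (D.dualBraiding hσ B)) :
    x ^ 2 + (q : ℂ) ^ 2 * ((q : ℂ) ^ 2 - 1) ^ 2 * (h₁ 0 1 * h₁ 1 0 - h₁ 0 0 * h₁ 1 1) ≠ 0 := by
  intro h0
  have hx0 := hD.ne_zero_of_injective hσ.1 hx
  have hq := pow_ne_zero 2 q.ne_zero
  have h := hD.dualBraiding_eq_smul_delta hσ hx B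
  rw [h0, zero_smul, map_eq_zero_iff _ hV] at h
  obtain ⟨-, -, ha, hu⟩ := eq_zero_of_sum_partialD_dz_eq_zero h
  have ha' := ((mul_eq_zero.1 ((mul_eq_zero.1 ha).resolve_left hx0)).resolve_left hq)
  have hu' := (mul_eq_zero.1 (neg_eq_zero.1 hu)).resolve_left hx0
  -- `ha'` and `hu'` say that both coefficients of the braiding of `∂_z ⊗ dz̄` are zero.
  have hk := hD.dualBraiding_partialz_dzbar hσ hx B
  have h1 : h₁ 0 0 * ((q : ℂ) ^ 4 - (q : ℂ) ^ 2) = 0 := by linear_combination (q : ℂ) ^ 2 * ha'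
  have h2 : h₁ 0 1 * ((q : ℂ) ^ 4 - (q : ℂ) ^ 2) - (q : ℂ) ^ 2 = 0 := by
    linear_combination -(q : ℂ) ^ 2 * hu'
  rw [h1, h2, zero_div, zero_smul, zero_smul, add_zero, map_eq_zero_iff _ hV] at hk
  have := congrArg (vecFormCoeff 0 1) hk
  simp at this

theorem IsPrescribed.diffDim_eq (hD : IsPrescribed D g₀ h₀ h₁)
    (hσ : Function.Bijective D.σ)
    (hx : x = ((q : ℂ) ^ 2 - 1) * (h₁ 0 1 - (q : ℂ) ^ 2 * h₁ 1 0) - 1)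
    (B : DualBasis (Sphere q) (Ω₁ q)) (hV : Function.Bijective (D.dualBraiding hσ B)) :
    diffDim D hσ B hV = algebraMap ℂ (Sphere q) (x * (x - 1) /
      (x ^ 2 + (q : ℂ) ^ 2 * ((q : ℂ) ^ 2 - 1) ^ 2 * (h₁ 0 1 * h₁ 1 0 - h₁ 0 0 * h₁ 1 1))) := by
  have hd := hD.denominator_ne_zero hσ hx B hV.1
  have hq := q.ne_zero
  have h := hD.dualBraiding_eq_smul_delta hσ hx B
  rw [← inv_smul_eq_iff₀ hd, ← map_smul] at h
  rw [diffDim, (LinearEquiv.symm_apply_eq _).2 h.symm]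
  simp only [map_add, map_smul, ev_bt, partialD_apply, dz_zero_zero, dz_zero_one, dz_one_zero,
    dz_one_one, smul_zero, add_zero, Algebra.algebraMap_eq_smul_one, ← add_smul, smul_smul]
  congr 1
  rw [div_eq_inv_mul]
  congr 1
  rw [hx]
  field_simp
  ring

end DualBraiding

end Sphere

end NCG

open NCG NCG.Sphere in
theorem mainTheorem11 (q : ℂˣ) :
    ∃ Dz Dzbar : Vec (Sphere q) (Ω₁ q),
      (Dz (dz q 0) = 1 ∧ Dz (dz q 1) = 0 ∧ Dzbar (dz q 0) = 0 ∧ Dzbar (dz q 1) = 1) ∧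
      Submodule.span (Sphere q) {Dz, Dzbar} = ⊤ ∧
      (∃ hA : Dzbar ⊗ₜ[ℂ] Dz - ((q : ℂ) ^ 2) • (Dz ⊗ₜ[ℂ] Dzbar) ∈ (calculus q).antisymm,
        (calculus q).bracket ⟨Dzbar ⊗ₜ[ℂ] Dz - ((q : ℂ) ^ 2) • (Dz ⊗ₜ[ℂ] Dzbar), hA⟩ = 0) ∧
      ∀ (g₀ h₀ h₁ : Fin 2 → Fin 2 → ℂ) (D : BimoduleConnection (calculus q) (Ω₁ q)),
        D.nabla (dz q 0) =
          (((q : ℂ)⁻¹ ^ 2) • (w q * zbar q)) • bt (Sphere q) (dz q 0) (dz q 0) +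
            ∑ i, ∑ j, (w q * (algebraMap ℂ (Sphere q) (g₀ i j) + ((q : ℂ) ^ 6 * h₁ i j) • z q)) •
              bt (Sphere q) (dz q i) (dz q j) →
        D.nabla (dz q 1) =
          (((q : ℂ) ^ 4) • (w q * z q)) • bt (Sphere q) (dz q 1) (dz q 1) +
            ∑ i, ∑ j, (w q * (algebraMap ℂ (Sphere q) (h₀ i j) + h₁ i j • zbar q)) •
              bt (Sphere q) (dz q i) (dz q j) →
        ∀ (hσ : Function.Bijective D.σ) (B : DualBasis (Sphere q) (Ω₁ q)) (x : ℂ),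
          x = ((q : ℂ) ^ 2 - 1) * (h₁ 0 1 - (q : ℂ) ^ 2 * h₁ 1 0) - 1 →
          x ≠ 0 ∧
          D.dualBraiding hσ B (bt (Sphere q) Dz (dz q 0)) =
            bt (Sphere q) (dz q 0) Dz
              + (h₁ 0 0 * (1 - (q : ℂ) ^ 2) / x) • bt (Sphere q) (dz q 0) Dzbar
              + (h₁ 1 0 * ((q : ℂ) ^ 2 - (q : ℂ) ^ 4) / x) • bt (Sphere q) (dz q 1) Dzbar ∧
          D.dualBraiding hσ B (bt (Sphere q) Dz (dz q 1)) =
            (h₁ 0 0 * ((q : ℂ) ^ 4 - (q : ℂ) ^ 2) / x) • bt (Sphere q) (dz q 0) Dz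
              + ((h₁ 0 1 * ((q : ℂ) ^ 4 - (q : ℂ) ^ 2) - (q : ℂ) ^ 2) / x) •
                bt (Sphere q) (dz q 1) Dz ∧
          D.dualBraiding hσ B (bt (Sphere q) Dzbar (dz q 0)) =
            ((h₁ 1 0 * (1 - (q : ℂ) ^ 2) - 1 / (q : ℂ) ^ 2) / x) • bt (Sphere q) (dz q 0) Dzbar
              + (h₁ 1 1 * (1 - (q : ℂ) ^ 2) / x) • bt (Sphere q) (dz q 1) Dzbar ∧
          D.dualBraiding hσ B (bt (Sphere q) Dzbar (dz q 1)) =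
            (h₁ 0 1 * ((q : ℂ) ^ 2 - 1) / x) • bt (Sphere q) (dz q 0) Dz
              + (h₁ 1 1 * ((q : ℂ) ^ 4 - (q : ℂ) ^ 2) / x) • bt (Sphere q) (dz q 1) Dz
              + bt (Sphere q) (dz q 1) Dzbar ∧
          ∀ hV : Function.Bijective (D.dualBraiding hσ B),
            x ^ 2 + (q : ℂ) ^ 2 * ((q : ℂ) ^ 2 - 1) ^ 2 * (h₁ 0 1 * h₁ 1 0 - h₁ 0 0 * h₁ 1 1) ≠ 0 ∧
            diffDim D hσ B hV =
              algebraMap ℂ (Sphere q)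
                (x * (x - 1) /
                  (x ^ 2 + (q : ℂ) ^ 2 * ((q : ℂ) ^ 2 - 1) ^ 2 *
                    (h₁ 0 1 * h₁ 1 0 - h₁ 0 0 * h₁ 1 1))) := by
  refine ⟨partialD q 0, partialD q 1, by simp, span_partialD,
    ⟨commutator_mem_antisymm, bracket_commutator⟩, ?_⟩
  intro g₀ h₀ h₁ D hz hzbar hσ B x hx
  have hD : IsPrescribed D g₀ h₀ h₁ := ⟨hz, hzbar⟩
  exact ⟨hD.ne_zero_of_injective hσ.1 hx, hD.dualBraiding_partialz_dz hσ hx B,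
    hD.dualBraiding_partialz_dzbar hσ hx B, hD.dualBraiding_partialzbar_dz hσ hx B,
    hD.dualBraiding_partialzbar_dzbar hσ hx B,
    fun hV => ⟨hD.denominator_ne_zero hσ hx B hV.1, hD.diffDim_eq hσ hx B hV⟩⟩
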